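/- **Theorem 1.1 (Kronecker limit formulas).** Let $\Gamma\subset\mathbb{C}$ be a lattice (a discrete subgroup spanning $\mathbb{C}$ over $\mathbb{R}$), let $A$ be the area of a fundamental domain of $\Gamma$ divided by $\pi$, and put $\langle z,w\rangle:=\exp\big((z\overline{w}-w\overline{z})/A\big)$. For $w\in\mathbb{C}$ let $s\mapsto K^*_0(0,w,s)$ be the meromorphic continuation to $\mathbb{C}$ of $$\sum_{\gamma\in\Gamma\setminus\{0\}}\frac{\langle\gamma,w\rangle}{|\gamma|^{2s}}\qquad(\operatorname{Re}(s)>1).$$ Let $\theta$ be the reduced theta function on $\mathbb{C}/\Gamma$ associated to the divisor $[0]$, normalized by $\theta'(0)=1$: the entire function with simple zeros exactly at the points of $\Gamma$ and $\theta'(0)=1$, for which there are a Hermitian form $H$ on $\mathbb{C}$ and a function $\psi$ on $\Gamma$ with $|\psi|=1$ such that $$\theta(z+\gamma)=\psi(\gamma)\exp\Big(\pi H(z,\gamma)+\frac{\pi}{2}H(\gamma,\gamma)\Big)\theta(z)\qquad(z\in\mathbb{C},\ \gamma\in\Gamma).$$ Let $c:=\lim_{n\to\infty}\left(1+\frac12+\cdots+\frac1n-\log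 n\right)$ be the Euler constant, and let $\Delta:=g_2^3-27g_3^2$ be the discriminant of $\Gamma$, where $$g_2:=60\sum_{\gamma\in\Gamma\setminus\{0\}}\gamma^{-4},\qquad g_3:=140\sum_{\gamma\in\Gamma\setminus\{0\}}\gamma^{-6}.$$ Then these continuations exist, $\theta$ exists and is unique, $\Delta\neq0$, and the following hold. (i) (First limit formula) $$\lim_{s\to1}\left(A\,K^*_0(0,0,s)-\frac{1}{s-1}\right)=-\frac{1}{12}\log|\Delta|^2-2\log A+2c.$$ (ii) (Second limit formula) For every $z\in\mathbb{C}$ with $z\notin\Gamma$, the function $K^*_0(0,z,s)$ has no pole at $s=1$, and $$A\,K^*_0(0,z,1)=-\log|\theta(z)|^2+\frac{|z|^2}{A}-\frac{1}{12}\log|\Delta|^2.$$ -/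

import Mathlib

open Filter Topology MeasureTheory

namespace KroneckerLimit

noncomputable section

/-- `A(Γ)`: the area of a fundamental domain of `Γ`, divided by `π`. -/
def areaDivPi (Γ : Submodule ℤ ℂ) : ℝ :=
  ZLattice.covolume Γ / Real.pi

/-- The pairing `⟨z, w⟩_Γ = exp ((z w̄ - w z̄) / A(Γ))`. -/
def pairing (Γ : Submodule ℤ ℂ) (z w : ℂ) : ℂ :=
  Complex.exp ((z * starRingEnd ℂ w - w * starRingEnd ℂ z) / (areaDivPi Γ : ℂ))

/-- The summand `(z̄₀ + γ̄)^a / |z₀ + γ|^(2s) · ⟨γ, w₀⟩_Γ` of the Eisenstein-Kronecker-Lerch series. -/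
def eklTerm (Γ : Submodule ℤ ℂ) (a : ℤ) (z₀ w₀ s γ : ℂ) : ℂ :=
  (starRingEnd ℂ z₀ + starRingEnd ℂ γ) ^ a / ((‖z₀ + γ‖ : ℝ) : ℂ) ^ (2 * s) * pairing Γ γ w₀

/-- `F` is the meromorphic function on `ℂ` obtained by analytic continuation from the
Eisenstein-Kronecker-Lerch series, which runs over all `γ ∈ Γ` with `γ ≠ -z₀` and converges
(absolutely) for `Re s > a/2 + 1`. Meromorphic functions are taken in normal form: `F` is analytic
at every point that is not a pole (and has the dummy value `0` at its poles), so that `F` is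
determined by the series at every point of `ℂ`. -/
structure IsEKLContinuation (Γ : Submodule ℤ ℂ) (a : ℤ) (z₀ w₀ : ℂ) (F : ℂ → ℂ) : Prop where
  meromorphic : MeromorphicNFOn F Set.univ
  hasSum : ∀ s : ℂ, (a : ℝ) / 2 + 1 < s.re →
    HasSum (fun γ : {γ : Γ // (γ : ℂ) ≠ -z₀} => eklTerm Γ a z₀ w₀ s ((γ : Γ) : ℂ)) (F s)

open Classical in
/-- The Eisenstein-Kronecker-Lerch function `s ↦ K*_a(z₀, w₀, s; Γ)` (the zero function if
there were no continuation). -/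
def ekl (Γ : Submodule ℤ ℂ) (a : ℤ) (z₀ w₀ : ℂ) : ℂ → ℂ :=
  if h : ∃ F : ℂ → ℂ, IsEKLContinuation Γ a z₀ w₀ F then h.choose else 0

/-- `g₂ = 60 ∑_{γ ≠ 0} γ⁻⁴`; the term of `γ = 0` is `0⁻¹ = 0`. -/
def g₂ (Γ : Submodule ℤ ℂ) : ℂ := 60 * ∑' γ : Γ, ((γ : ℂ) ^ 4)⁻¹

/-- `g₃ = 140 ∑_{γ ≠ 0} γ⁻⁶`; the term of `γ = 0` is `0⁻¹ = 0`. -/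
def g₃ (Γ : Submodule ℤ ℂ) : ℂ := 140 * ∑' γ : Γ, ((γ : ℂ) ^ 6)⁻¹

/-- The discriminant `Δ = g₂³ - 27 g₃²` of the lattice. -/
def discr (Γ : Submodule ℤ ℂ) : ℂ := g₂ Γ ^ 3 - 27 * g₃ Γ ^ 2

/-- `θ` is a reduced (normalized) theta function on `ℂ / Γ`: an entire function, not identically
zero, such that for a Hermitian form `H(z, w) = h z w̄` (`h` real) and a function `ψ` on `Γ` of
absolute value one
`θ(z + γ) = ψ(γ) exp(π H(z, γ) + (π/2) H(γ, γ)) θ(z)` for all `z ∈ ℂ`, `γ ∈ Γ`.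
(That `Im H` is integral on `Γ` and that `ψ` is a semi-character for `Im H` follows.) -/
structure IsReducedTheta (Γ : Submodule ℤ ℂ) (θ : ℂ → ℂ) : Prop where
  entire : Differentiable ℂ θ
  ne_zero : θ ≠ 0
  transformation : ∃ (h : ℝ) (ψ : Γ → Circle), ∀ (z : ℂ) (γ : Γ),
    θ (z + γ) = (ψ γ : ℂ) *
      Complex.exp (Real.pi * (h * z * starRingEnd ℂ (γ : ℂ)) +
        Real.pi / 2 * (h * (γ : ℂ) * starRingEnd ℂ (γ : ℂ))) * θ z

/-- `θ` is the reduced theta function on `ℂ / Γ` associated to the divisor `[0]` (it vanishes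
exactly on `Γ`, to order one), normalized by `θ'(0) = 1`. -/
structure IsNormalizedTheta (Γ : Submodule ℤ ℂ) (θ : ℂ → ℂ) : Prop where
  isReducedTheta : IsReducedTheta Γ θ
  order_of_mem : ∀ z ∈ Γ, analyticOrderAt θ z = 1
  ne_zero_of_notMem : ∀ z ∉ Γ, θ z ≠ 0
  deriv_zero : deriv θ 0 = 1

end

end KroneckerLimit

/-!
After scaling, `Γ` is `ω (ℤτ + ℤ)` with `τ` in the upper half plane (`exists_isSpannedBy`), and a
point `w = ω (bτ + a)` turns the pairing `⟨γ, w⟩` into the character `latChar a b` of `ℤ × ℤ`.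
Everything is then a computation in the nome `q = exp (2πiτ)` with the product
`qProd q u = ∏ (1 - qⁿ u)`.

*Continuation.* Poisson summation gives a functional equation of the theta function of the lattice
with a character (`tsum_latChar_mul_exp`). Its Mellin transform continues the
Eisenstein-Kronecker-Lerch series (`exists_entire_hasSum`); the only possible pole is at `s = 1`,
and it is there exactly if `w ∈ Γ`. So the value at `s = 1`, or the constant term there, is a limit
along real `s > 1`, and this is what has to be computed.

*Limits.* At `s = 1` a single row `m ≠ 0` of the lattice sum is a Fourier series with a closed form
(`hasSum_row`), and the rows `m` and `-m` together are the terms of the Lambert series of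
`log |qProd|` (`rowSum_add_rowSum_neg`, `log_norm_qProd`). The row of the origin is a value of the
second Bernoulli polynomial. The double series does not converge absolutely at `s = 1`, so passing
to the limit needs an argument: if the character is not trivial on the rows, summation by parts
along the rows makes the series absolutely convergent (`tendsto_latSum`); if the character is
trivial, subtracting from each term an integral over a unit segment does so, and the subtracted
integrals add up to a multiple of `ζ(2s - 1)`, which carries the pole and Euler's constant
(`tendsto_latSum_zero`). A point on the line through `0` and `ω` is moved off it by exchanging the
basis vectors.

*The theta function.* The Jacobi triple product, times the exponential of a quadratic polynomial, is
a reduced theta function with simple zeros on the lattice (`productTheta`). It is the only one up to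
a constant: the quotient of two of them is entire without zeros, and its absolute value times a
Gaussian is periodic, so that it or its inverse is bounded (`IsSpannedBy.theta_eq_of_le`).

*The discriminant.* `Δ = (2π / ω)¹² q ∏ (1 - qⁿ)²⁴` (`IsSpannedBy.discr_eq`), from the product
formula for the modular discriminant. Comparing logarithms of absolute values gives both formulas.
-/

namespace KroneckerLimit

noncomputable section

open Complex

open UpperHalfPlane hiding I

open scoped Real

/-! ### Theta functions of the lattice with a character -/

/-- The point `mτ + n` of the lattice `ℤτ + ℤ` with coordinates `p = (m, n)`. -/
def latPt (τ : ℍ) (p : ℤ × ℤ) : ℂ := p.1 * τ + p.2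

/-- The character `(m, n) ↦ exp (2πi (ma - nb))` of `ℤ × ℤ`; it is the pairing of the lattice point
`mτ + n` with the point `bτ + a`. -/
def latChar (a b : ℝ) (p : ℤ × ℤ) : ℂ := cexp (2 * π * I * (p.1 * a - p.2 * b))

lemma norm_latChar (a b : ℝ) (p : ℤ × ℤ) : ‖latChar a b p‖ = 1 := by
  rw [latChar, show (2 * π * I * (p.1 * a - p.2 * b) : ℂ)
    = ((2 * π * (p.1 * a - p.2 * b) : ℝ) : ℂ) * I by push_cast; ring, norm_exp_ofReal_mul_I]

lemma norm_latPt_sq (τ : ℍ) (p : ℤ × ℤ) :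
    ‖latPt τ p‖ ^ 2 = (p.2 + p.1 * τ.re) ^ 2 + (p.1 * τ.im) ^ 2 := by
  rw [← normSq_eq_norm_sq, normSq_apply]
  simp [latPt]
  ring

lemma latPt_eq_zero_iff (τ : ℍ) (p : ℤ × ℤ) : latPt τ p = 0 ↔ p = 0 := by
  refine ⟨fun h ↦ ?_, fun h ↦ by simp [latPt, h]⟩
  have h1 := congrArg Complex.im h
  have h2 := congrArg Complex.re h
  simp [latPt, τ.im_ne_zero] at h1 h2
  ext <;> simp_all

lemma summable_norm_latPt_rpow (τ : ℍ) {r : ℝ} (hr : 2 < r) :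
    Summable fun p ↦ ‖latPt τ p‖ ^ (-r) := by
  rw [← (finTwoArrowEquiv ℤ).summable_iff]
  have h := (EisensteinSeries.summable_one_div_norm_rpow hr).mul_left (EisensteinSeries.r τ ^ (-r))
  refine h.of_nonneg_of_le (fun v ↦ Real.rpow_nonneg (norm_nonneg _) _) fun v ↦ ?_
  simpa [latPt] using EisensteinSeries.summand_bound τ (by linarith : 0 ≤ r) v

lemma exp_neg_le_two_div_sq {u : ℝ} (hu : 0 < u) : Real.exp (-u) ≤ 2 / u ^ 2 := by
  rw [Real.exp_neg, inv_eq_one_div, div_le_div_iff₀ (Real.exp_pos _) (by positivity)]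
  nlinarith [Real.quadratic_le_exp_of_nonneg hu.le]

lemma summable_exp_neg_norm_latPt (τ : ℍ) {c : ℝ} (hc : 0 < c) :
    Summable fun p ↦ Real.exp (-(c * ‖latPt τ p‖ ^ 2)) := by
  have h := (summable_norm_latPt_rpow τ (r := 4) (by norm_num)).mul_left (2 / c ^ 2)
  have h0 : Summable fun p : ℤ × ℤ ↦ if p = 0 then (1 : ℝ) else 0 :=
    (hasSum_ite_eq (0 : ℤ × ℤ) (1 : ℝ)).summable
  refine (h.add h0).of_nonneg_of_le (fun p ↦ by positivity) fun p ↦ ?_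
  by_cases hp : p = 0
  · simp [hp, latPt]
  · have h1 : 0 < ‖latPt τ p‖ := by rwa [norm_pos_iff, Ne, latPt_eq_zero_iff]
    refine (exp_neg_le_two_div_sq (by positivity)).trans_eq ?_
    rw [if_neg hp, Real.rpow_neg h1.le, show (4 : ℝ) = (4 : ℕ) by norm_num, Real.rpow_natCast]
    field_simp
    simp

lemma summable_exp_neg_norm_add_latPt (τ : ℍ) (z : ℂ) {c : ℝ} (hc : 0 < c) :
    Summable fun p ↦ Real.exp (-(c * ‖z + latPt τ p‖ ^ 2)) := by
  have h := (summable_exp_neg_norm_latPt τ (half_pos hc)).mul_left (Real.exp (c * ‖z‖ ^ 2))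
  refine h.of_nonneg_of_le (fun p ↦ by positivity) fun p ↦ ?_
  rw [← Real.exp_add, Real.exp_le_exp]
  have h1 : ‖latPt τ p‖ ≤ ‖z + latPt τ p‖ + ‖z‖ := by
    simpa using norm_sub_le (z + latPt τ p) z
  nlinarith [norm_nonneg (latPt τ p), norm_nonneg z, norm_nonneg (z + latPt τ p),
    sq_nonneg (‖z + latPt τ p‖ - ‖z‖), pow_le_pow_left₀ (norm_nonneg (latPt τ p)) h1 2]

lemma summable_exp_add_latPt (τ : ℍ) (z : ℂ) (c : ℝ) (hc : 0 < c) :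
    Summable fun p ↦ Real.exp (-π * (‖z + latPt τ p‖ ^ 2 / τ.im) * c) := by
  have hy := τ.im_pos
  refine (summable_exp_neg_norm_add_latPt τ z (c := π / τ.im * c) (by positivity)).congr fun p ↦ ?_
  ring_nf

lemma summable_exp_latPt (τ : ℍ) (c : ℝ) (hc : 0 < c) :
    Summable fun p ↦ Real.exp (-π * (‖latPt τ p‖ ^ 2 / τ.im) * c) := by
  simpa using summable_exp_add_latPt τ 0 c hc

/-- Poisson summation for a one-dimensional Gaussian with characteristics. -/
lemma tsum_gaussian_char {α : ℝ} (hα : 0 < α) (b c : ℝ) :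
    ∑' n : ℤ, cexp (-π * α * (n + c) ^ 2 - 2 * π * I * n * b)
      = 1 / (√α : ℂ) * ∑' n : ℤ, cexp (-π / α * (n + b) ^ 2 + 2 * π * I * c * (n + b)) := by
  have hα' : (α : ℂ) ≠ 0 := by exact_mod_cast hα.ne'
  have h := Complex.tsum_exp_neg_quadratic (a := α) (by simpa using hα) (-α * c - I * b)
  have hs : (α : ℂ) ^ (1 / 2 : ℂ) = (√α : ℂ) := by
    rw [Real.sqrt_eq_rpow, ofReal_cpow hα.le]; simp
  rw [hs] at h
  calc _ = cexp (-π * α * c ^ 2) *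
        ∑' n : ℤ, cexp (-π * α * n ^ 2 + 2 * π * (-α * c - I * b) * n) := by
        rw [← tsum_mul_left]
        congr 1 with n
        rw [← Complex.exp_add]
        ring_nf
    _ = _ := by
        rw [h, mul_left_comm, ← tsum_mul_left]
        congr 2 with n
        have key : (n + I * (-α * c - I * b) : ℂ) ^ 2
            = (n + b) ^ 2 - 2 * I * α * c * (n + b) - α ^ 2 * c ^ 2 := by
          linear_combination (α ^ 2 * c ^ 2 + 2 * I * α * b * c + b ^ 2 * (I ^ 2 - 1)
            - 2 * n * b) * I_sq
        rw [key, ← Complex.exp_add]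
        congr 1
        field_simp
        ring

lemma summable_exp_neg_mul_int_sq {α : ℝ} (hα : 0 < α) (b : ℝ) :
    Summable fun n : ℤ ↦ Real.exp (-π * α * (n + b) ^ 2) := by
  have h := (summable_exp_neg_norm_add_latPt UpperHalfPlane.I b (mul_pos Real.pi_pos hα)).comp_injective
    (i := fun n : ℤ ↦ ((0, n) : ℤ × ℤ)) (fun m n h ↦ by simpa using h)
  refine h.congr fun n ↦ ?_
  simp only [Function.comp, latPt]
  rw [show ((b : ℂ) + (((0 : ℤ) : ℂ) * (UpperHalfPlane.I : ℂ) + (n : ℂ))) = ((n + b : ℝ) : ℂ) by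
    push_cast; ring, norm_real, Real.norm_eq_abs, sq_abs]
  ring_nf

/-- The summand of the double series that is obtained from the theta function of the lattice
`ℤτ + ℤ` by Poisson summation in the second coordinate. -/
def mixedGaussian (τ : ℍ) (a b t : ℝ) (q : ℤ × ℤ) : ℂ :=
  cexp (-π * (τ.im / t : ℝ) * q.1 ^ 2) * cexp (-π * (τ.im * t : ℝ) * (q.2 + b) ^ 2)
    * cexp (2 * π * I * q.1 * (a + (q.2 + b) * τ.re))

lemma summable_mixedGaussian (τ : ℍ) (a b : ℝ) {t : ℝ} (ht : 0 < t) :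
    Summable (mixedGaussian τ a b t) := by
  have hy := τ.im_pos
  apply Summable.of_norm
  have h := (summable_exp_neg_mul_int_sq (div_pos hy ht) 0).mul_of_nonneg
    (summable_exp_neg_mul_int_sq (mul_pos hy ht) b) (fun _ ↦ by positivity) (fun _ ↦ by positivity)
  refine h.congr fun q ↦ ?_
  have h1 : (2 * π * I * q.1 * (a + (q.2 + b) * τ.re) : ℂ)
      = ((2 * π * q.1 * (a + (q.2 + b) * τ.re) : ℝ) : ℂ) * I := by push_cast; ring
  have h2 : (-π * (τ.im / t : ℝ) * q.1 ^ 2 : ℂ)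
      = ((-π * (τ.im / t) * (q.1 + 0) ^ 2 : ℝ) : ℂ) := by push_cast; ring
  have h3 : (-π * (τ.im * t : ℝ) * (q.2 + b) ^ 2 : ℂ)
      = ((-π * (τ.im * t) * (q.2 + b) ^ 2 : ℝ) : ℂ) := by push_cast; ring
  rw [mixedGaussian, norm_mul, norm_mul, h1, h2, h3, norm_exp_ofReal_mul_I, mul_one,
    norm_exp_ofReal, norm_exp_ofReal]

/-- Poisson summation in the second coordinate of the theta function of the lattice. -/
lemma tsum_latChar_mul_exp_row (τ : ℍ) (a b : ℝ) {t : ℝ} (ht : 0 < t) (m : ℤ) :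
    ∑' n : ℤ, latChar a b (m, n) * Real.exp (-π * (‖latPt τ (m, n)‖ ^ 2 / τ.im) * (1 / t))
      = √(τ.im * t) * ∑' k : ℤ, mixedGaussian τ a b t (m, k) := by
  have hy := τ.im_pos
  have hyC : (τ.im : ℂ) ≠ 0 := by exact_mod_cast hy.ne'
  have htC : (t : ℂ) ≠ 0 := by exact_mod_cast ht.ne'
  have h := tsum_gaussian_char (α := 1 / (τ.im * t)) (by positivity) b (m * τ.re)
  have hs : 1 / (√(1 / (τ.im * t)) : ℂ) = √(τ.im * t) := by
    rw [Real.sqrt_div zero_le_one, Real.sqrt_one]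
    push_cast
    rw [one_div_one_div]
  rw [hs] at h
  calc _ = cexp (2 * π * I * m * a - π * (τ.im / t) * m ^ 2) * ∑' n : ℤ, cexp (-π *
        (1 / (τ.im * t) : ℝ) * (n + (m * τ.re : ℝ)) ^ 2 - 2 * π * I * n * b) := by
        rw [← tsum_mul_left]
        congr 1 with n
        rw [norm_latPt_sq, latChar, ofReal_exp, ← Complex.exp_add, ← Complex.exp_add]
        congr 1
        push_cast
        field_simp
        ring
    _ = _ := by
        rw [h, mul_left_comm, ← tsum_mul_left]
        congr 2 with k
        rw [mixedGaussian, ← Complex.exp_add, ← Complex.exp_add, ← Complex.exp_add]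
        congr 1
        push_cast
        field_simp
        ring

/-- Poisson summation in the first coordinate of the mixed double series. -/
lemma tsum_mixedGaussian_column (τ : ℍ) (a b : ℝ) {t : ℝ} (ht : 0 < t) (k : ℤ) :
    ∑' m : ℤ, mixedGaussian τ a b t (m, k) = √(t / τ.im) * ∑' l : ℤ,
      (Real.exp (-π * (‖(b * τ + a : ℂ) + latPt τ (k, l)‖ ^ 2 / τ.im) * t) : ℂ) := by
  have hy := τ.im_pos
  have hyC : (τ.im : ℂ) ≠ 0 := by exact_mod_cast hy.ne'
  have htC : (t : ℂ) ≠ 0 := by exact_mod_cast ht.ne'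
  have h := tsum_gaussian_char (α := τ.im / t) (by positivity) (-(a + (k + b) * τ.re)) 0
  have hs : 1 / (√(τ.im / t) : ℂ) = √(t / τ.im) := by
    rw [Real.sqrt_div hy.le, Real.sqrt_div ht.le]
    push_cast
    rw [one_div_div]
  rw [hs] at h
  calc _ = cexp (-π * (τ.im * t : ℝ) * (k + b) ^ 2) * ∑' m : ℤ, cexp (-π *
        (τ.im / t : ℝ) * (m + (0 : ℝ)) ^ 2 - 2 * π * I * m * (-(a + (k + b) * τ.re) : ℝ)) := by
        rw [← tsum_mul_left]
        congr 1 with n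
        rw [mixedGaussian, ← Complex.exp_add, ← Complex.exp_add, ← Complex.exp_add]
        congr 1
        push_cast
        ring
    _ = _ := by
        rw [h, mul_left_comm, ← tsum_mul_left, ← (Equiv.neg ℤ).tsum_eq]
        congr 2 with l
        rw [ofReal_exp, ← Complex.exp_add]
        congr 1
        have hn : ‖(b * τ + a : ℂ) + latPt τ (k, l)‖ ^ 2
            = (l + a + (k + b) * τ.re) ^ 2 + ((k + b) * τ.im) ^ 2 := by
          rw [← normSq_eq_norm_sq, normSq_apply]
          simp [latPt]
          ring
        rw [hn]
        simp only [Equiv.neg_apply]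
        push_cast
        field_simp
        ring

/-- The functional equation of the theta function of the lattice `ℤτ + ℤ` with a character: the
dual series is a sum over the lattice shifted by the point that defines the character. -/
lemma tsum_latChar_mul_exp (τ : ℍ) (a b : ℝ) {t : ℝ} (ht : 0 < t) :
    ∑' p, latChar a b p * Real.exp (-π * (‖latPt τ p‖ ^ 2 / τ.im) * (1 / t)) =
      t * ∑' p, (Real.exp (-π * (‖(b * τ + a : ℂ) + latPt τ p‖ ^ 2 / τ.im) * t) : ℂ) := by
  have hy := τ.im_pos
  have hsum : Summable fun p ↦ latChar a b p *
      Real.exp (-π * (‖latPt τ p‖ ^ 2 / τ.im) * (1 / t)) := by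
    apply Summable.of_norm
    refine (summable_exp_latPt τ (1 / t) (by positivity)).congr fun p ↦ ?_
    rw [norm_mul, norm_latChar, one_mul, norm_real, Real.norm_of_nonneg (Real.exp_pos _).le]
  have hsum' : Summable fun p ↦
      (Real.exp (-π * (‖(b * τ + a : ℂ) + latPt τ p‖ ^ 2 / τ.im) * t) : ℂ) := by
    apply Summable.of_norm
    refine (summable_exp_add_latPt τ (b * τ + a) t ht).congr fun p ↦ ?_
    rw [norm_real, Real.norm_of_nonneg (Real.exp_pos _).le]
  rw [hsum.tsum_prod, hsum'.tsum_prod]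
  simp_rw [tsum_latChar_mul_exp_row τ a b ht]
  rw [tsum_mul_left, ← Summable.tsum_comm (f := fun m k ↦ mixedGaussian τ a b t (m, k))
    (summable_mixedGaussian τ a b ht)]
  simp_rw [tsum_mixedGaussian_column τ a b ht]
  rw [tsum_mul_left, ← mul_assoc, ← ofReal_mul, ← Real.sqrt_mul (by positivity)]
  congr 2
  rw [show τ.im * t * (t / τ.im) = t ^ 2 by field_simp, Real.sqrt_sq ht.le]

/-! ### Meromorphic continuation -/

section ExponentialSums

variable {ι : Type*} {p : ι → ℝ} {a : ι → ℂ}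

lemma finite_setOf_le_one (hs : ∀ c > 0, Summable fun i ↦ Real.exp (-π * p i * c)) :
    {i | p i ≤ 1}.Finite := by
  have h := (hs 1 one_pos).tendsto_cofinite_zero.eventually_lt_const (Real.exp_pos (-π))
  refine (eventually_cofinite.mp h).subset fun i hi ↦ ?_
  simp only [Set.mem_ofPred_eq, not_lt, Real.exp_le_exp] at hi ⊢
  nlinarith [Real.pi_pos]

lemma exists_pos_le_of_summable (hs : ∀ c > 0, Summable fun i ↦ Real.exp (-π * p i * c))
    (hp : ∀ i, 0 ≤ p i) : ∃ δ > 0, ∀ i, p i ≠ 0 → δ ≤ p i := by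
  have hfin : (insert 1 (p '' {i | p i ≤ 1} \ {0})).Finite :=
    (((finite_setOf_le_one hs).image p).subset Set.sdiff_subset).insert 1
  obtain ⟨δ, hδ, hmin⟩ := Set.exists_min_image _ id hfin (Set.insert_nonempty _ _)
  refine ⟨δ, ?_, fun i hi ↦ ?_⟩
  · rcases hδ with rfl | ⟨⟨i, -, rfl⟩, hi⟩
    · exact one_pos
    · exact lt_of_le_of_ne (hp i) (Ne.symm hi)
  · rcases le_total (p i) 1 with h | h
    · exact hmin _ (Or.inr ⟨⟨i, h, rfl⟩, hi⟩)
    · exact (hmin 1 (Set.mem_insert _ _)).trans h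

lemma norm_mul_exp_le (ha : ∀ i, ‖a i‖ ≤ 1) (i : ι) (t : ℝ) :
    ‖a i * Real.exp (-π * p i * t)‖ ≤ Real.exp (-π * p i * t) := by
  rw [norm_mul, norm_real, Real.norm_of_nonneg (Real.exp_pos _).le]
  exact mul_le_of_le_one_left (Real.exp_pos _).le (ha i)

lemma hasSum_exp_sub_const (hs : ∀ c > 0, Summable fun i ↦ Real.exp (-π * p i * c))
    (ha : ∀ i, ‖a i‖ ≤ 1) {t : ℝ} (ht : 0 < t) :
    HasSum (fun i ↦ if p i = 0 then 0 else a i * Real.exp (-π * p i * t))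
      (∑' i, a i * Real.exp (-π * p i * t) - ∑' i, if p i = 0 then a i else 0) := by
  have h1 : Summable fun i ↦ a i * Real.exp (-π * p i * t) :=
    (hs t ht).of_norm_bounded fun i ↦ norm_mul_exp_le ha i t
  have h2 : Summable fun i ↦ if p i = 0 then a i else 0 := by
    refine summable_of_hasFiniteSupport ((finite_setOf_le_one hs).subset fun i hi ↦ ?_)
    by_contra h
    exact hi (if_neg fun h0 ↦ h (by simp [h0]))
  convert! h1.hasSum.sub h2.hasSum using 2 with i
  split_ifs with h <;> simp [h]

lemma isBigO_exp_sub_const (hs : ∀ c > 0, Summable fun i ↦ Real.exp (-π * p i * c))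
    (hp : ∀ i, 0 ≤ p i) (ha : ∀ i, ‖a i‖ ≤ 1) (r : ℝ) :
    (fun t : ℝ ↦ ∑' i, a i * Real.exp (-π * p i * t) - ∑' i, if p i = 0 then a i else 0)
      =O[atTop] (· ^ r) := by
  obtain ⟨δ, hδ, hδp⟩ := exists_pos_le_of_summable hs hp
  refine Asymptotics.IsBigO.trans ?_ (isLittleO_exp_neg_mul_rpow_atTop
    (mul_pos Real.pi_pos hδ) r).isBigO
  refine Asymptotics.IsBigO.of_bound (Real.exp (π * δ) * ∑' i, Real.exp (-π * p i * 1)) ?_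
  filter_upwards [eventually_ge_atTop 1] with t ht
  rw [← (hasSum_exp_sub_const hs ha (one_pos.trans_le ht)).tsum_eq, Real.norm_of_nonneg
    (Real.exp_pos _).le, mul_right_comm, ← tsum_mul_left]
  refine tsum_of_norm_bounded ((hs 1 one_pos).mul_left _).hasSum fun i ↦ ?_
  split_ifs with h
  · rw [norm_zero]
    positivity
  · refine (norm_mul_exp_le ha i t).trans ?_
    rw [← Real.exp_add, ← Real.exp_add, Real.exp_le_exp]
    nlinarith [mul_le_mul_of_nonneg_left (mul_le_mul_of_nonneg_right (hδp i h)
      (sub_nonneg.mpr ht)) Real.pi_pos.le]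

lemma continuousOn_tsum_exp (hs : ∀ c > 0, Summable fun i ↦ Real.exp (-π * p i * c))
    (hp : ∀ i, 0 ≤ p i) (ha : ∀ i, ‖a i‖ ≤ 1) :
    ContinuousOn (fun t : ℝ ↦ ∑' i, a i * Real.exp (-π * p i * t)) (Set.Ioi 0) := by
  intro t ht
  have ht : 0 < t := ht
  have h : ContinuousOn (fun t : ℝ ↦ ∑' i, a i * Real.exp (-π * p i * t)) (Set.Ioi (t / 2)) := by
    refine continuousOn_tsum (fun i ↦ by fun_prop) (hs (t / 2) (half_pos ht)) fun i x hx ↦ ?_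
    refine (norm_mul_exp_le ha i x).trans (Real.exp_le_exp.mpr ?_)
    nlinarith [mul_le_mul_of_nonneg_left (le_of_lt (Set.mem_Ioi.mp hx))
      (mul_nonneg Real.pi_pos.le (hp i))]
  exact (h.continuousAt (Ioi_mem_nhds (half_lt_self ht))).continuousWithinAt

end ExponentialSums

/-- The number (`0` or `1`) of lattice points of `ℤτ + ℤ` equal to `-(bτ + a)`; it governs the
pole of the Eisenstein-Kronecker-Lerch series at `s = 1`. -/
def dualConst (τ : ℍ) (a b : ℝ) : ℂ :=
  ∑' p, if ‖(b * τ + a : ℂ) + latPt τ p‖ ^ 2 / τ.im = 0 then 1 else 0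

lemma dualConst_zero (τ : ℍ) : dualConst τ 0 0 = 1 := by
  rw [dualConst, tsum_eq_single 0]
  · simp [latPt]
  · intro p hp
    rw [Ne, ← latPt_eq_zero_iff τ] at hp
    simp [hp, τ.im_ne_zero]

lemma dualConst_eq_zero (τ : ℍ) {a b : ℝ} (h : ∀ p, (b * τ + a : ℂ) ≠ latPt τ p) :
    dualConst τ a b = 0 := by
  have h' (p : ℤ × ℤ) : (b * τ + a : ℂ) + latPt τ p ≠ 0 := fun h0 ↦ by
    refine h (-p) ?_
    rw [eq_neg_of_add_eq_zero_left h0]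
    simp [latPt]
    ring
  simp [dualConst, h', τ.im_ne_zero]

/-- The pair of theta functions of the lattice `ℤτ + ℤ`, the first with a character and the second
with a shift, exchanged by `t ↦ 1 / t`. -/
def thetaPair (τ : ℍ) (a b : ℝ) : WeakFEPair ℂ where
  f t := ∑' p, latChar a b p * Real.exp (-π * (‖latPt τ p‖ ^ 2 / τ.im) * t)
  g t := ∑' p, (1 : ℂ) * Real.exp (-π * (‖(b * τ + a : ℂ) + latPt τ p‖ ^ 2 / τ.im) * t)
  k := 1
  ε := 1
  f₀ := ∑' p, if ‖latPt τ p‖ ^ 2 / τ.im = 0 then latChar a b p else 0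
  g₀ := dualConst τ a b
  hf_int := (continuousOn_tsum_exp (summable_exp_latPt τ) (fun p ↦ by have := τ.im_pos; positivity)
    fun p ↦ (norm_latChar a b p).le).locallyIntegrableOn measurableSet_Ioi
  hg_int := (continuousOn_tsum_exp (summable_exp_add_latPt τ _)
    (fun p ↦ by have := τ.im_pos; positivity)
    fun p ↦ norm_one.le).locallyIntegrableOn measurableSet_Ioi
  hk := one_pos
  hε := one_ne_zero
  h_feq t ht := by simpa using tsum_latChar_mul_exp τ a b ht
  hf_top := isBigO_exp_sub_const (summable_exp_latPt τ) (fun p ↦ by have := τ.im_pos; positivity)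
    fun p ↦ (norm_latChar a b p).le
  hg_top := isBigO_exp_sub_const (summable_exp_add_latPt τ _)
    (fun p ↦ by have := τ.im_pos; positivity) fun p ↦ norm_one.le

lemma thetaPair_f₀ (τ : ℍ) (a b : ℝ) : (thetaPair τ a b).f₀ = 1 := by
  change ∑' p, (if ‖latPt τ p‖ ^ 2 / τ.im = 0 then latChar a b p else 0) = 1
  rw [tsum_eq_single 0]
  · simp [latPt, latChar]
  · intro p hp
    rw [Ne, ← latPt_eq_zero_iff τ] at hp
    simp [hp, τ.im_ne_zero]

lemma ofReal_sq_div_cpow {x y : ℝ} (hx : 0 ≤ x) (hy : 0 < y) {s : ℂ} (hs : s ≠ 0) :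
    ((x ^ 2 / y : ℝ) : ℂ) ^ s = (x : ℂ) ^ (2 * s) / (y : ℂ) ^ s := by
  rcases hx.eq_or_lt with rfl | hx
  · simp [hs]
  · rw [cpow_def_of_ne_zero (by exact_mod_cast (by positivity : x ^ 2 / y ≠ 0)),
      cpow_def_of_ne_zero (by exact_mod_cast hx.ne'), cpow_def_of_ne_zero (by exact_mod_cast hy.ne'),
      ← Complex.exp_sub, ← ofReal_log (by positivity), ← ofReal_log hx.le, ← ofReal_log hy.le,
      Real.log_div (by positivity) hy.ne', Real.log_pow]
    push_cast
    ring_nf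

/-- The Eisenstein-Kronecker-Lerch series of `ℤτ + ℤ` in terms of an entire function, obtained as
a Mellin transform of the theta function. -/
lemma exists_entire_hasSum (τ : ℍ) (a b : ℝ) : ∃ Λ₀ : ℂ → ℂ, Differentiable ℂ Λ₀ ∧
    ∀ s : ℂ, 1 < s.re → HasSum (fun p ↦ latChar a b p / (‖latPt τ p‖ : ℂ) ^ (2 * s))
      ((π : ℂ) ^ s / (τ.im : ℂ) ^ s / Gamma s * (Λ₀ s - 1 / s - dualConst τ a b / (1 - s))) := by
  let P := thetaPair τ a b
  refine ⟨P.Λ₀, P.differentiable_Λ₀, fun s hs ↦ ?_⟩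
  have hy := τ.im_pos
  have hs0 : s ≠ 0 := fun h ↦ by simp [h] at hs; linarith
  have hG : Gamma s ≠ 0 := Gamma_ne_zero_of_re_pos (by linarith)
  have hπ : (π : ℂ) ^ s ≠ 0 := by simp [cpow_eq_zero_iff, Real.pi_ne_zero]
  have hyC : (τ.im : ℂ) ^ s ≠ 0 := by simp [cpow_eq_zero_iff, τ.im_ne_zero]
  have hM := P.hasMellin (s := s) hs
  have hsum : Summable fun p ↦ ‖latChar a b p‖ / (‖latPt τ p‖ ^ 2 / τ.im) ^ s.re := by
    refine ((summable_norm_latPt_rpow τ (r := 2 * s.re) (by linarith)).mul_left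
      (τ.im ^ s.re)).congr fun p ↦ ?_
    rw [norm_latChar, Real.div_rpow (by positivity) hy.le, ← Real.rpow_natCast,
      ← Real.rpow_mul (norm_nonneg _), Real.rpow_neg (norm_nonneg _)]
    push_cast
    field_simp
  have h := hasSum_mellin_pi_mul₀ (a := latChar a b) (p := fun p ↦ ‖latPt τ p‖ ^ 2 / τ.im)
    (F := fun t ↦ P.f t - P.f₀) (s := s) (fun p ↦ by positivity) (by linarith)
    (fun t ht ↦ hasSum_exp_sub_const (summable_exp_latPt τ) (fun p ↦ (norm_latChar a b p).le) ht)
    hsum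
  rw [hM.2] at h
  have hΛ : P.Λ s = P.Λ₀ s - 1 / s - dualConst τ a b / (1 - s) := by
    rw [WeakFEPair.Λ, show P.f₀ = 1 from thetaPair_f₀ τ a b, show P.g₀ = dualConst τ a b from rfl,
      show P.ε = 1 from rfl, show P.k = 1 from rfl]
    simp [div_eq_inv_mul]
  rw [← hΛ]
  refine (h.mul_left ((π : ℂ) ^ s / (τ.im : ℂ) ^ s / Gamma s)).congr_fun fun p ↦ ?_
  rw [ofReal_sq_div_cpow (norm_nonneg _) hy hs0, cpow_neg]
  field_simp

/-! ### Rows of the lattice sum at `s = 1` -/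

/-- Pointwise convergence of the Fourier series of a continuous function on `[0, 1]` with equal
values at the end points and summable Fourier coefficients `c`. -/
lemma hasSum_fourier_of_endpoints_eq {f : ℝ → ℂ} (hf : Continuous f) (h01 : f 0 = f 1)
    {c : ℤ → ℂ} (hc : ∀ n : ℤ, ∫ x in (0 : ℝ)..1, cexp (-(2 * π * I * n * x)) * f x = c n)
    (hsum : Summable c) {y : ℝ} (hy : y ∈ Set.Ico (0 : ℝ) 1) :
    HasSum (fun n : ℤ ↦ c n * cexp (2 * π * I * n * y)) (f y) := by
  let B : C(UnitAddCircle, ℂ) := ⟨AddCircle.liftIco 1 0 f,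
    AddCircle.liftIco_zero_continuous h01 hf.continuousOn⟩
  have hfe (n : ℤ) (x : ℝ) : (fourier n (x : UnitAddCircle) : ℂ) = cexp (2 * π * I * n * x) := by
    refine (fourier_coe_apply (T := 1)).trans ?_
    simp
  have hB (n : ℤ) : fourierCoeff B n = c n := by
    rw [ContinuousMap.coe_mk, fourierCoeff_liftIco_eq, fourierCoeffOn_eq_integral, ← hc]
    simp only [sub_zero, zero_add, one_div, inv_one, one_smul, smul_eq_mul]
    refine intervalIntegral.integral_congr fun x _ ↦ ?_
    congr 1
    refine fourier_coe_apply.trans ?_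
    simp
  have h := has_pointwise_sum_fourier_series_of_summable (f := B)
    (hsum.congr fun n ↦ (hB n).symm) y
  have hBy : B y = f y := by
    rw [ContinuousMap.coe_mk, AddCircle.liftIco_coe_apply (by rwa [zero_add])]
  rw [hBy] at h
  refine h.congr_fun fun n ↦ ?_
  simp [hB, hfe, -fourier_apply]

lemma summable_inv_norm_add_int_sq (w : ℂ) : Summable fun n : ℤ ↦ 1 / ‖w + n‖ ^ 2 := by
  have h := ((EisensteinSeries.linear_inv_isBigO_right 1 w).norm_left.pow 2)
  refine summable_of_isBigO (g := fun n : ℤ ↦ 1 / (n : ℝ) ^ 2)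
    (Real.summable_one_div_int_pow.mpr one_lt_two) ?_
  simpa using h

lemma exp_two_pi_I_mul_ne_one {w : ℂ} (hw : w.im ≠ 0) : cexp (2 * π * I * w) ≠ 1 := by
  intro h
  obtain ⟨n, hn⟩ := Complex.exp_eq_one_iff.mp h
  have h2 : w = n := by
    have : (2 * π * I : ℂ) ≠ 0 := two_pi_I_ne_zero
    exact mul_left_cancel₀ this (by rw [hn]; ring)
  simp [h2] at hw

lemma integral_exp_neg_mul_exp {w : ℂ} (hw : w.im ≠ 0) (n : ℤ) :
    ∫ x in (0 : ℝ)..1, cexp (-(2 * π * I * n * x)) * cexp (2 * π * I * w * x)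
      = (cexp (2 * π * I * w) - 1) / (2 * π * I * (w - n)) := by
  have hwn : w - n ≠ 0 := fun h ↦ hw (by rw [sub_eq_zero.mp h]; simp)
  have h := integral_exp_mul_complex (a := 0) (b := 1)
    (mul_ne_zero two_pi_I_ne_zero hwn)
  convert! h using 3 with x
  · rw [← Complex.exp_add]
    ring_nf
  · rw [ofReal_one, mul_one, mul_sub, Complex.exp_sub, mul_comm _ (n : ℂ), exp_int_mul_two_pi_mul_I,
      div_one]
  · simp

/-- The sum of a row of the lattice sum at `s = 1`. -/
lemma hasSum_row {w : ℂ} (hw : 0 < w.im) {b : ℝ} (hb : b ∈ Set.Ico (0 : ℝ) 1) :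
    HasSum (fun n : ℤ ↦ cexp (-(2 * π * I * n * b)) / ((‖w + n‖ ^ 2 : ℝ) : ℂ))
      (π / w.im * (cexp (2 * π * I * w * b) / (1 - cexp (2 * π * I * w))
        + starRingEnd ℂ (cexp (2 * π * I * w * (1 - b)) / (1 - cexp (2 * π * I * w))))) := by
  set w' := starRingEnd ℂ w with hw'
  have hw'im : w'.im = -w.im := conj_im w
  have h1 := exp_two_pi_I_mul_ne_one hw.ne'
  have h2 := exp_two_pi_I_mul_ne_one (w := w') (by simp [hw'im, hw.ne'])
  have h1' : 1 - cexp (2 * π * I * w) ≠ 0 := sub_ne_zero.mpr h1.symm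
  have h2' : 1 - cexp (2 * π * I * w') ≠ 0 := sub_ne_zero.mpr h2.symm
  have hv : (w.im : ℂ) ≠ 0 := by exact_mod_cast hw.ne'
  have hπ : (π : ℂ) ≠ 0 := by exact_mod_cast Real.pi_ne_zero
  -- By partial fractions of `1 / ((w - n) (w̄ - n))`, the Fourier coefficients of `f` are the
  -- numbers `1 / |w - n|²`.
  let f : ℝ → ℂ := fun x ↦ π / w.im * (cexp (2 * π * I * w * x) / (1 - cexp (2 * π * I * w))
    - cexp (2 * π * I * w' * x) / (1 - cexp (2 * π * I * w')))
  have hf : Continuous f := by fun_prop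
  have h01 : f 0 = f 1 := by
    simp only [f, ofReal_zero, mul_zero, Complex.exp_zero, ofReal_one, mul_one]
    generalize cexp (2 * π * I * w) = Q at h1'
    generalize cexp (2 * π * I * w') = Q' at h2'
    field_simp
    ring
  have hc (n : ℤ) : ∫ x in (0 : ℝ)..1, cexp (-(2 * π * I * n * x)) * f x
      = ((1 / ‖w + (-n : ℤ)‖ ^ 2 : ℝ) : ℂ) := by
    have hwn : w - n ≠ 0 := fun h ↦ hw.ne' (by rw [sub_eq_zero.mp h]; simp)
    have hwn' : w' - n ≠ 0 := fun h ↦ hw.ne' (by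
      have := congrArg Complex.im (sub_eq_zero.mp h)
      simpa [hw'im] using this)
    calc _ = ∫ x in (0 : ℝ)..1, (π / w.im / (1 - cexp (2 * π * I * w)) *
          (cexp (-(2 * π * I * n * x)) * cexp (2 * π * I * w * x))
          - π / w.im / (1 - cexp (2 * π * I * w')) *
          (cexp (-(2 * π * I * n * x)) * cexp (2 * π * I * w' * x))) := by
          congr 1 with x
          simp only [f]
          ring
      _ = _ := by
          rw [intervalIntegral.integral_sub (Continuous.intervalIntegrable (by fun_prop) _ _)
            (Continuous.intervalIntegrable (by fun_prop) _ _),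
            intervalIntegral.integral_const_mul, intervalIntegral.integral_const_mul,
            integral_exp_neg_mul_exp hw.ne', integral_exp_neg_mul_exp (by simp [hw'im, hw.ne'])]
          have hsq : ((‖w + (-n : ℤ)‖ ^ 2 : ℝ) : ℂ) = (w - n) * (w' - n) := by
            rw [← normSq_eq_norm_sq, ← mul_conj]
            simp [hw', sub_eq_add_neg]
          have him : (2 * w.im * I : ℂ) = w - w' := by
            rw [hw', Complex.sub_conj]
            push_cast
            ring
          push_cast at hsq ⊢
          rw [hsq]
          have e1 : (π : ℂ) / w.im / (1 - cexp (2 * π * I * w)) *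
              ((cexp (2 * π * I * w) - 1) / (2 * π * I * (w - n)))
              = -1 / (2 * w.im * I) / (w - n) := by
            generalize cexp (2 * π * I * w) = Q at h1'
            field_simp
            ring
          have e2 : (π : ℂ) / w.im / (1 - cexp (2 * π * I * w')) *
              ((cexp (2 * π * I * w') - 1) / (2 * π * I * (w' - n)))
              = -1 / (2 * w.im * I) / (w' - n) := by
            generalize cexp (2 * π * I * w') = Q' at h2'
            field_simp
            ring
          rw [e1, e2]
          have hI : (2 * w.im * I : ℂ) ≠ 0 := by simp [hw.ne']
          rw [him] at hI ⊢
          field_simp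
          ring
  have hsum : Summable fun n : ℤ ↦ ((1 / ‖w + (-n : ℤ)‖ ^ 2 : ℝ) : ℂ) := by
    apply Summable.of_norm
    refine ((Equiv.neg ℤ).summable_iff.mpr (summable_inv_norm_add_int_sq w)).congr fun n ↦ ?_
    rw [norm_real, Real.norm_of_nonneg (by positivity)]
    simp
  have h := hasSum_fourier_of_endpoints_eq hf h01 hc hsum hb
  rw [← (Equiv.neg ℤ).hasSum_iff] at h
  convert! h using 1
  · ext n
    simp only [Function.comp_apply, Equiv.neg_apply, neg_neg]
    push_cast
    rw [div_eq_mul_one_div, mul_comm]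
    ring_nf
  · simp only [f]
    congr 1
    have hconj : starRingEnd ℂ (cexp (2 * π * I * w)) = (cexp (2 * π * I * w'))⁻¹ := by
      rw [← Complex.exp_conj, ← Complex.exp_neg]
      simp only [map_mul, conj_I, conj_ofReal, Complex.conj_ofNat, hw']
      ring_nf
    have hconj2 : starRingEnd ℂ (cexp (2 * π * I * w * (1 - b)))
        = (cexp (2 * π * I * w'))⁻¹ * cexp (2 * π * I * w' * b) := by
      rw [← Complex.exp_conj, ← Complex.exp_neg, ← Complex.exp_add]
      simp only [map_mul, map_sub, map_one, conj_I, conj_ofReal, Complex.conj_ofNat, hw']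
      ring_nf
    rw [map_div₀, map_sub (starRingEnd ℂ) 1, map_one, hconj, hconj2]
    have hE := Complex.exp_ne_zero (2 * π * I * w')
    have h3 : cexp (2 * π * I * w') - 1 ≠ 0 := sub_ne_zero.mpr h2
    generalize cexp (2 * π * I * w') = Q' at h2' hE h3
    field_simp
    ring

/-! ### The `q`-product and its logarithm -/

/-- The infinite product `∏_{n ≥ 0} (1 - qⁿ u)`. -/
def qProd (q u : ℂ) : ℂ := ∏' n : ℕ, (1 - q ^ n * u)

lemma norm_pow_mul_pow_div_le {q u : ℂ} (hq : ‖q‖ < 1) (n m : ℕ) :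
    ‖(q ^ n * u) ^ m / m‖ ≤ ‖q‖ ^ n * ‖u‖ ^ m := by
  rcases Nat.eq_zero_or_pos m with rfl | hm
  · simp
  · have h1 : ‖q‖ ^ n ≤ 1 := pow_le_one₀ (norm_nonneg _) hq.le
    have h2 : (1 : ℝ) ≤ m := by exact_mod_cast hm
    rw [norm_div, norm_pow, norm_mul, norm_pow, norm_natCast, mul_pow]
    refine (div_le_self (by positivity) h2).trans ?_
    exact mul_le_mul_of_nonneg_right (pow_le_of_le_one (by positivity) h1 hm.ne') (by positivity)

lemma summable_pow_mul_pow_div {q u : ℂ} (hq : ‖q‖ < 1) (hu : ‖u‖ < 1) :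
    Summable fun p : ℕ × ℕ ↦ (q ^ p.1 * u) ^ p.2 / p.2 :=
  ((summable_geometric_of_lt_one (norm_nonneg _) hq).mul_of_nonneg
    (summable_geometric_of_lt_one (norm_nonneg _) hu) (fun _ ↦ by positivity)
    (fun _ ↦ by positivity)).of_norm_bounded fun p ↦ norm_pow_mul_pow_div_le hq p.1 p.2

lemma norm_pow_mul_lt_one {q u : ℂ} (hq : ‖q‖ < 1) (hu : ‖u‖ < 1) (n : ℕ) : ‖q ^ n * u‖ < 1 := by
  rw [norm_mul, norm_pow]
  exact mul_lt_one_of_nonneg_of_lt_one_right (pow_le_one₀ (norm_nonneg _) hq.le) (norm_nonneg _) hu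

lemma hasSum_pow_div_one_sub_pow {q u : ℂ} (hq : ‖q‖ < 1) (hu : ‖u‖ < 1) :
    HasSum (fun m : ℕ ↦ u ^ m / (m * (1 - q ^ m))) (∑' n : ℕ, -log (1 - q ^ n * u)) := by
  have hs := summable_pow_mul_pow_div hq hu
  have h1 (n : ℕ) := hasSum_taylorSeries_neg_log (norm_pow_mul_lt_one hq hu n)
  have h2 (m : ℕ) : HasSum (fun n : ℕ ↦ (q ^ n * u) ^ m / m) (u ^ m / (m * (1 - q ^ m))) := by
    rcases Nat.eq_zero_or_pos m with rfl | hm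
    · simp
    · have hqm : ‖q ^ m‖ < 1 := by
        rw [norm_pow]
        exact pow_lt_one₀ (norm_nonneg _) hq hm.ne'
      convert! (hasSum_geometric_of_norm_lt_one hqm).mul_left (u ^ m / m) using 1
      · ext n
        ring
      · rw [div_mul_eq_div_div, div_eq_mul_inv]
  rw [← tsum_congr fun n ↦ (h1 n).tsum_eq, ← hs.tsum_prod]
  have h3 := hs.hasSum
  rw [← (Equiv.prodComm ℕ ℕ).hasSum_iff] at h3
  exact h3.prod_fiberwise h2

/-- The logarithm of the `q`-product as a Lambert series. -/
lemma log_norm_qProd {q u : ℂ} (hq : ‖q‖ < 1) (hu : ‖u‖ < 1) :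
    HasSum (fun m : ℕ ↦ (u ^ m / (m * (1 - q ^ m))).re) (-Real.log ‖qProd q u‖) := by
  have h := hasSum_pow_div_one_sub_pow hq hu
  have hs : Summable fun n : ℕ ↦ log (1 - q ^ n * u) := by
    refine (summable_pow_mul_pow_div hq hu).prod.neg.congr fun n ↦ ?_
    rw [(hasSum_taylorSeries_neg_log (norm_pow_mul_lt_one hq hu n)).tsum_eq, neg_neg]
  have hne (n : ℕ) : 1 - q ^ n * u ≠ 0 := fun h0 ↦ by
    have := norm_pow_mul_lt_one hq hu n
    rw [← sub_eq_zero.mp h0] at this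
    simp at this
  have hexp : cexp (∑' n : ℕ, log (1 - q ^ n * u)) = qProd q u := cexp_tsum_eq_tprod hne hs
  rw [← hexp, norm_exp, Real.log_exp]
  simpa [tsum_neg] using hasSum_re h

/-! ### The rows of the lattice sum -/

/-- The nome `exp (2πiτ)`. -/
def nome (τ : ℍ) : ℂ := cexp (2 * π * I * τ)

lemma norm_exp_two_pi_I_mul (w : ℂ) : ‖cexp (2 * π * I * w)‖ = Real.exp (-2 * π * w.im) := by
  rw [norm_exp]
  simp

lemma norm_nome_lt_one (τ : ℍ) : ‖nome τ‖ < 1 := by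
  rw [nome, norm_exp_two_pi_I_mul, Real.exp_lt_one_iff]
  have := mul_pos Real.pi_pos τ.im_pos
  simp only [coe_im]
  linarith

lemma latChar_neg (a b : ℝ) (p : ℤ × ℤ) : latChar a b (-p) = starRingEnd ℂ (latChar a b p) := by
  rw [latChar, latChar, ← Complex.exp_conj]
  simp only [map_mul, map_sub, conj_I, conj_ofReal, Complex.conj_ofNat, Prod.fst_neg, Prod.snd_neg,
    map_intCast]
  push_cast
  ring_nf

lemma latPt_neg (τ : ℍ) (p : ℤ × ℤ) : latPt τ (-p) = -latPt τ p := by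
  simp [latPt]
  ring

/-- The sum of the row `m` of the lattice sum at `s = 1`. -/
def rowSum (τ : ℍ) (a b : ℝ) (m : ℤ) : ℂ :=
  ∑' n : ℤ, latChar a b (m, n) * ((‖latPt τ (m, n)‖ ^ (-2 : ℝ) : ℝ) : ℂ)

lemma hasSum_rowSum (τ : ℍ) (a : ℝ) {b : ℝ} (hb : b ∈ Set.Ico (0 : ℝ) 1) {m : ℕ} (hm : m ≠ 0) :
    HasSum (fun n : ℤ ↦ latChar a b (m, n) * ((‖latPt τ (m, n)‖ ^ (-2 : ℝ) : ℝ) : ℂ))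
      (π / (m * τ.im) * (cexp (2 * π * I * (b * τ + a)) ^ m / (1 - nome τ ^ m)
        + starRingEnd ℂ (cexp (2 * π * I * ((1 - b) * τ - a)) ^ m / (1 - nome τ ^ m)))) := by
  have hm' : (0 : ℝ) < m := by exact_mod_cast Nat.pos_of_ne_zero hm
  have him : (m * τ : ℂ).im = m * τ.im := by simp
  have h := (hasSum_row (w := m * τ) (by rw [him]; exact mul_pos hm' τ.im_pos) hb).mul_left
    (cexp (2 * π * I * (m * a)))
  rw [him] at h
  convert! h using 1
  · ext n
    rw [latChar, Real.rpow_neg (norm_nonneg _), show (2 : ℝ) = (2 : ℕ) by norm_num,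
      Real.rpow_natCast, mul_div_assoc', ← Complex.exp_add, div_eq_mul_inv]
    simp only [latPt, Int.cast_natCast]
    push_cast
    ring_nf
  · have e1 : nome τ ^ m = cexp (2 * π * I * (m * τ)) := by
      rw [nome, ← Complex.exp_nat_mul]
      ring_nf
    have e2 : cexp (2 * π * I * (b * τ + a)) ^ m
        = cexp (2 * π * I * (m * a)) * cexp (2 * π * I * (m * τ) * b) := by
      rw [← Complex.exp_nat_mul, ← Complex.exp_add]
      ring_nf
    have e3 : starRingEnd ℂ (cexp (2 * π * I * ((1 - b) * τ - a)) ^ m)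
        = cexp (2 * π * I * (m * a)) *
          starRingEnd ℂ (cexp (2 * π * I * (m * τ) * (1 - b))) := by
      have : cexp (2 * π * I * (m * a)) = starRingEnd ℂ (cexp (-(2 * π * I * (m * a)))) := by
        rw [← Complex.exp_conj]
        simp only [map_mul, map_neg, conj_I, conj_ofReal, Complex.conj_ofNat, map_natCast]
        ring_nf
      rw [this, ← map_mul, ← Complex.exp_nat_mul, ← Complex.exp_add]
      ring_nf
    rw [map_div₀, map_div₀, e1, e2, e3]
    push_cast
    ring

lemma rowSum_neg (τ : ℍ) (a b : ℝ) (m : ℤ) :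
    rowSum τ a b (-m) = starRingEnd ℂ (rowSum τ a b m) := by
  rw [rowSum, rowSum, conj_tsum, ← (Equiv.neg ℤ).tsum_eq]
  congr 1 with n
  have h : ((-m, (Equiv.neg ℤ) n) : ℤ × ℤ) = -(m, n) := rfl
  rw [h, latChar_neg, latPt_neg, norm_neg, map_mul, conj_ofReal]

/-- Two opposite rows of the lattice sum at `s = 1`. -/
lemma rowSum_add_rowSum_neg (τ : ℍ) (a : ℝ) {b : ℝ} (hb : b ∈ Set.Ico (0 : ℝ) 1) {m : ℕ}
    (hm : m ≠ 0) : rowSum τ a b m + rowSum τ a b (-m) =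
      ((2 * π / τ.im * ((cexp (2 * π * I * (b * τ + a)) ^ m / (m * (1 - nome τ ^ m))).re
        + (cexp (2 * π * I * ((1 - b) * τ - a)) ^ m / (m * (1 - nome τ ^ m))).re) : ℝ) : ℂ) := by
  have hm' : (m : ℝ) ≠ 0 := by exact_mod_cast hm
  have hy := τ.im_ne_zero
  have hdiv (z : ℂ) : (z / (m * (1 - nome τ ^ m))).re = (z / (1 - nome τ ^ m)).re / m := by
    rw [mul_comm, ← div_div, ← ofReal_natCast, div_ofReal_re]
  rw [rowSum_neg, rowSum, (hasSum_rowSum τ a hb hm).tsum_eq, add_conj, hdiv, hdiv]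
  rw [show (π / (m * τ.im) : ℂ) = ((π / (m * τ.im) : ℝ) : ℂ) by push_cast; ring, re_ofReal_mul,
    add_re, conj_re]
  congr 1
  field_simp

/-! ### The limit `s → 1` of the lattice sum, nontrivial character -/

/-- The difference of `x ^ (-2s)` at two points at distance at most one is `O(Y⁻³)`, uniformly for
`1 ≤ s ≤ 2`: one power better than the values, which is what makes lattice sums converge. -/
lemma exists_abs_rpow_sub_rpow_le {c : ℝ} (hc : 0 < c) : ∃ C : ℝ, ∀ X Y s : ℝ, c ≤ X → c ≤ Y →
    |X - Y| ≤ 1 → s ∈ Set.Icc (1 : ℝ) 2 → |X ^ (-2 * s) - Y ^ (-2 * s)| ≤ C * Y ^ (-3 : ℝ) := by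
  -- `k` is chosen so that `[Y / k, ∞)` contains both points, and `d ≤ 1` is a lower bound of `Y / k`.
  set k : ℝ := 1 + 1 / c with hk
  have hk0 : 0 < k := by positivity
  set d : ℝ := min (c / k) 1 with hd
  have hd0 : 0 < d := lt_min (by positivity) one_pos
  refine ⟨4 * d ^ (-2 : ℝ) * k ^ (3 : ℝ), fun X Y s hX hY hXY hs ↦ ?_⟩
  have hY0 : 0 < Y := hc.trans_le hY
  have hYk : 0 < Y / k := by positivity
  have hYX : Y / k ≤ X := by
    rw [div_le_iff₀ hk0, hk]
    have h1 : Y ≤ X + 1 := by linarith [(abs_le.mp hXY).1]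
    have h2 : 1 ≤ X * (1 / c) := by rw [mul_one_div, one_le_div hc]; exact hX
    linarith
  have hYY : Y / k ≤ Y := div_le_self hY0.le (by rw [hk]; linarith [one_div_pos.mpr hc])
  have hder : ∀ x ∈ Set.Ici (Y / k), HasDerivWithinAt (fun x : ℝ ↦ x ^ (-2 * s))
      (-2 * s * x ^ (-2 * s - 1)) (Set.Ici (Y / k)) x := fun x hx ↦
    (Real.hasDerivAt_rpow_const (Or.inl (hYk.trans_le hx).ne')).hasDerivWithinAt
  have hdY : d ≤ Y / k := (min_le_left _ _).trans (div_le_div_of_nonneg_right hY hk0.le)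
  have hbound : ∀ x ∈ Set.Ici (Y / k), ‖-2 * s * x ^ (-2 * s - 1)‖
      ≤ 4 * d ^ (-2 : ℝ) * k ^ (3 : ℝ) * Y ^ (-3 : ℝ) := by
    intro x hx
    have hx0 : 0 < x := hYk.trans_le hx
    have h1 : x ^ (-2 * s - 1) ≤ (Y / k) ^ (-2 * s - 1) :=
      Real.rpow_le_rpow_of_nonpos hYk hx (by linarith [hs.1])
    have h2 : (Y / k) ^ (-2 * s - 1) = (Y / k) ^ (-(2 * s - 2)) * (Y / k) ^ (-3 : ℝ) := by
      rw [← Real.rpow_add hYk]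
      ring_nf
    have h3 : (Y / k) ^ (-(2 * s - 2)) ≤ d ^ (-(2 * s - 2)) :=
      Real.rpow_le_rpow_of_nonpos hd0 hdY (by linarith [hs.1])
    have h4 : d ^ (-(2 * s - 2)) ≤ d ^ (-2 : ℝ) :=
      Real.rpow_le_rpow_of_exponent_ge hd0 (min_le_right _ _) (by linarith [hs.2])
    have h5 : (Y / k) ^ (-3 : ℝ) = k ^ (3 : ℝ) * Y ^ (-3 : ℝ) := by
      rw [Real.div_rpow hY0.le hk0.le, Real.rpow_neg hk0.le]
      field_simp
    rw [norm_mul, Real.norm_of_nonneg (Real.rpow_nonneg hx0.le _), Real.norm_eq_abs,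
      abs_of_nonpos (by linarith [hs.1]), mul_assoc, mul_assoc, ← h5]
    refine mul_le_mul (by linarith [hs.2]) (h1.trans ?_) (by positivity) (by norm_num)
    rw [h2]
    exact mul_le_mul_of_nonneg_right (h3.trans h4) (by positivity)
  have h := (convex_Ici (Y / k)).norm_image_sub_le_of_norm_hasDerivWithin_le hder hbound hYY hYX
  rw [Real.norm_eq_abs, Real.norm_eq_abs] at h
  exact h.trans (mul_le_of_le_one_right (by positivity) hXY)

lemma im_le_norm_latPt_add (τ : ℍ) {p : ℤ × ℤ} (hp : p.1 ≠ 0) (u : ℝ) :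
    τ.im ≤ ‖latPt τ p + u‖ := by
  have h1 : |(latPt τ p + u).im| ≤ ‖latPt τ p + u‖ := abs_im_le_norm _
  have h2 : (latPt τ p + u).im = p.1 * τ.im := by simp [latPt]
  have h3 : (1 : ℝ) ≤ |(p.1 : ℝ)| := by exact_mod_cast Int.one_le_abs hp
  rw [h2, abs_mul, abs_of_pos τ.im_pos] at h1
  nlinarith [τ.im_pos]

/-- The absolute value of the summand of the Eisenstein-Kronecker-Lerch series at `p + (0, u)`,
without the row of the origin. -/
def rowsTerm (τ : ℍ) (s : ℝ) (p : ℤ × ℤ) (u : ℝ) : ℝ :=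
  if p.1 = 0 then 0 else ‖latPt τ p + u‖ ^ (-2 * s)

lemma exists_abs_rowsTerm_sub_le (τ : ℍ) : ∃ C : ℝ, ∀ (s : ℝ) (p : ℤ × ℤ) (u : ℝ),
    s ∈ Set.Icc (1 : ℝ) 2 → u ∈ Set.Icc (0 : ℝ) 1 →
      |rowsTerm τ s p u - rowsTerm τ s p 0| ≤ C * ‖latPt τ p‖ ^ (-3 : ℝ) := by
  obtain ⟨C, hC⟩ := exists_abs_rpow_sub_rpow_le τ.im_pos
  have hC0 : 0 ≤ C * (τ.im) ^ (-3 : ℝ) :=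
    (abs_nonneg _).trans (hC τ.im τ.im 1 le_rfl le_rfl (by simp) (by norm_num))
  have hC0 : 0 ≤ C := nonneg_of_mul_nonneg_left hC0 (by have := τ.im_pos; positivity)
  refine ⟨C, fun s p u hs hu ↦ ?_⟩
  by_cases hp : p.1 = 0
  · simp only [rowsTerm, hp, if_true, sub_self, abs_zero]
    exact mul_nonneg hC0 (Real.rpow_nonneg (norm_nonneg _) _)
  · simp only [rowsTerm, hp, if_false]
    have h0 := im_le_norm_latPt_add τ hp 0
    rw [ofReal_zero, add_zero] at h0 ⊢
    refine hC _ _ s (im_le_norm_latPt_add τ hp u) h0 ?_ hs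
    refine (abs_norm_sub_norm_le _ _).trans ?_
    rw [add_sub_cancel_left, norm_real, Real.norm_of_nonneg hu.1]
    exact hu.2

lemma tendsto_rowsTerm (τ : ℍ) (p : ℤ × ℤ) (u : ℝ) :
    Tendsto (fun s ↦ rowsTerm τ s p u) (𝓝[>] 1) (𝓝 (rowsTerm τ 1 p u)) := by
  refine Tendsto.mono_left ?_ nhdsWithin_le_nhds
  by_cases hp : p.1 = 0
  · simp [rowsTerm, hp]
  · simp only [rowsTerm, hp, if_false]
    refine ContinuousAt.tendsto ((Real.continuousAt_const_rpow ?_).comp (by fun_prop))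
    exact (τ.im_pos.trans_le (im_le_norm_latPt_add τ hp u)).ne'

lemma summable_rowsTerm (τ : ℍ) {s : ℝ} (hs : 1 < s) : Summable fun p ↦ rowsTerm τ s p 0 := by
  refine (summable_norm_latPt_rpow τ (r := 2 * s) (by linarith)).of_nonneg_of_le (fun p ↦ ?_)
    fun p ↦ ?_
  · rw [rowsTerm]
    positivity
  · rw [rowsTerm]
    split_ifs
    · positivity
    · rw [ofReal_zero, add_zero, neg_mul]

lemma norm_latChar_mul_ofReal (a b : ℝ) (p : ℤ × ℤ) (x : ℝ) :
    ‖latChar a b p * (x : ℂ)‖ = |x| := by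
  rw [norm_mul, norm_latChar, one_mul, norm_real, Real.norm_eq_abs]

lemma rowsTerm_shift (τ : ℍ) (s : ℝ) (m n : ℤ) :
    rowsTerm τ s (m, n) 1 = rowsTerm τ s (m, n + 1) 0 := by
  simp [rowsTerm, latPt, add_assoc]

lemma latChar_shift (a b : ℝ) (m n : ℤ) :
    latChar a b (m, n) = cexp (2 * π * I * b) * latChar a b (m, n + 1) := by
  rw [latChar, latChar, ← Complex.exp_add]
  push_cast
  ring_nf

/-- Summation by parts along a row. -/
lemma tsum_latChar_mul_sub_shift {a b : ℝ} {m : ℤ} {f : ℤ → ℂ}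
    (hf : Summable fun n ↦ latChar a b (m, n) * f n) :
    ∑' n, latChar a b (m, n) * (f (n + 1) - f n) =
      (cexp (2 * π * I * b) - 1) * ∑' n, latChar a b (m, n) * f n := by
  have h1 : HasSum (fun n ↦ latChar a b (m, n) * f (n + 1))
      (cexp (2 * π * I * b) * ∑' n, latChar a b (m, n) * f n) := by
    have h := ((Equiv.addRight (1 : ℤ)).hasSum_iff.mpr hf.hasSum).mul_left (cexp (2 * π * I * b))
    refine h.congr_fun fun n ↦ ?_
    rw [latChar_shift a b m n]
    simp [mul_assoc]
  rw [sub_one_mul, ← (h1.sub hf.hasSum).tsum_eq]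
  congr 1 with n
  ring

lemma summable_rowsTerm_row (τ : ℍ) (a b : ℝ) (m : ℤ) :
    Summable fun n ↦ latChar a b (m, n) * (rowsTerm τ 1 (m, n) 0 : ℂ) := by
  apply Summable.of_norm
  refine (summable_inv_norm_add_int_sq (m * τ)).of_nonneg_of_le (fun n ↦ norm_nonneg _) fun n ↦ ?_
  rw [norm_latChar_mul_ofReal, rowsTerm]
  split_ifs
  · rw [abs_zero]
    positivity
  · rw [ofReal_zero, add_zero, abs_of_nonneg (by positivity), mul_one, Real.rpow_neg (norm_nonneg _),
      one_div, show (2 : ℝ) = (2 : ℕ) by norm_num, Real.rpow_natCast, latPt]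

lemma tsum_rowsTerm_one (τ : ℍ) (a b : ℝ) (m : ℤ) :
    ∑' n, latChar a b (m, n) * (rowsTerm τ 1 (m, n) 0 : ℂ) = if m = 0 then 0 else rowSum τ a b m := by
  split_ifs with hm
  · simp [rowsTerm, hm]
  · simp [rowsTerm, hm, rowSum]

/-- The sum over all rows other than that of the origin, for a character that is nontrivial on the
rows. Summation by parts along the rows makes the series converge absolutely at `s = 1`. -/
lemma tendsto_tsum_rowsTerm (τ : ℍ) (a : ℝ) {b : ℝ} (hb : cexp (2 * π * I * b) ≠ 1) :
    Summable (fun m : ℤ ↦ if m = 0 then 0 else rowSum τ a b m) ∧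
    Tendsto (fun s : ℝ ↦ ∑' p, latChar a b p * (rowsTerm τ s p 0 : ℂ)) (𝓝[>] 1)
      (𝓝 (∑' m : ℤ, if m = 0 then 0 else rowSum τ a b m)) := by
  obtain ⟨C, hC⟩ := exists_abs_rowsTerm_sub_le τ
  have hsum3 : Summable fun p ↦ C * ‖latPt τ p‖ ^ (-3 : ℝ) :=
    (summable_norm_latPt_rpow τ (by norm_num)).mul_left C
  have hb' : cexp (2 * π * I * b) - 1 ≠ 0 := sub_ne_zero.mpr hb
  have hbd (s : ℝ) (hs : s ∈ Set.Icc (1 : ℝ) 2) (p : ℤ × ℤ) :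
      ‖latChar a b p * ((rowsTerm τ s p 1 : ℂ) - rowsTerm τ s p 0)‖
        ≤ C * ‖latPt τ p‖ ^ (-3 : ℝ) := by
    rw [← ofReal_sub, norm_latChar_mul_ofReal]
    exact hC s p 1 hs (by norm_num)
  have hdiff : Summable fun p ↦ latChar a b p * ((rowsTerm τ 1 p 1 : ℂ) - rowsTerm τ 1 p 0) :=
    hsum3.of_norm_bounded (hbd 1 (by norm_num))
  have hrow (m : ℤ) : ∑' n, latChar a b (m, n) *
      ((rowsTerm τ 1 (m, n) 1 : ℂ) - rowsTerm τ 1 (m, n) 0)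
      = (cexp (2 * π * I * b) - 1) * (if m = 0 then 0 else rowSum τ a b m) := by
    simp_rw [rowsTerm_shift]
    rw [tsum_latChar_mul_sub_shift (f := fun n ↦ (rowsTerm τ 1 (m, n) 0 : ℂ))
      (summable_rowsTerm_row τ a b m), tsum_rowsTerm_one]
  have hlim : Tendsto (fun s : ℝ ↦ ∑' p, latChar a b p *
      ((rowsTerm τ s p 1 : ℂ) - rowsTerm τ s p 0)) (𝓝[>] 1)
      (𝓝 (∑' p, latChar a b p * ((rowsTerm τ 1 p 1 : ℂ) - rowsTerm τ 1 p 0))) := by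
    refine tendsto_tsum_of_dominated_convergence hsum3 (fun p ↦ ?_) ?_
    · exact (((continuous_ofReal.tendsto _).comp (tendsto_rowsTerm τ p 1)).sub
        ((continuous_ofReal.tendsto _).comp (tendsto_rowsTerm τ p 0))).const_mul _
    · filter_upwards [Ioc_mem_nhdsGT (one_lt_two (α := ℝ))] with s hs p
      exact hbd s ⟨hs.1.le, hs.2⟩ p
  have hsumm := hdiff.prod
  simp_rw [hrow] at hsumm
  refine ⟨(summable_mul_left_iff hb').mp hsumm, ?_⟩
  rw [hdiff.tsum_prod] at hlim
  simp_rw [hrow] at hlim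
  rw [tsum_mul_left] at hlim
  have h2 := hlim.const_mul (cexp (2 * π * I * b) - 1)⁻¹
  rw [inv_mul_cancel_left₀ hb'] at h2
  refine h2.congr' ?_
  filter_upwards [self_mem_nhdsWithin] with s hs
  rw [inv_mul_eq_iff_eq_mul₀ hb']
  have hs1 : Summable fun p ↦ latChar a b p * (rowsTerm τ s p 0 : ℂ) := by
    apply Summable.of_norm
    simp_rw [norm_latChar_mul_ofReal]
    exact (summable_rowsTerm τ hs).abs
  have hs2 : Summable fun p ↦ latChar a b p * (rowsTerm τ s p 1 : ℂ) := by
    apply Summable.of_norm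
    simp_rw [norm_latChar_mul_ofReal]
    have h := ((Equiv.prodCongrRight fun _ : ℤ ↦ Equiv.addRight (1 : ℤ)).summable_iff.mpr
      (summable_rowsTerm τ hs)).abs
    refine h.congr fun p ↦ ?_
    rw [show p = (p.1, p.2) from rfl, rowsTerm_shift]
    rfl
  have hs3 : Summable fun p ↦ latChar a b p * ((rowsTerm τ s p 1 : ℂ) - rowsTerm τ s p 0) := by
    simpa [mul_sub] using hs2.sub hs1
  rw [hs3.tsum_prod, hs1.tsum_prod, ← tsum_mul_left]
  congr 1 with m
  simp_rw [rowsTerm_shift]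
  exact tsum_latChar_mul_sub_shift (f := fun n ↦ (rowsTerm τ s (m, n) 0 : ℂ)) (hs1.prod_factor m)

/-- The Eisenstein-Kronecker-Lerch series of `ℤτ + ℤ` at a real point `s`. -/
def latSum (τ : ℍ) (a b s : ℝ) : ℂ := ∑' p, latChar a b p * ((‖latPt τ p‖ ^ (-2 * s) : ℝ) : ℂ)

lemma summable_latChar_mul (τ : ℍ) (a b : ℝ) {s : ℝ} (hs : 1 < s) :
    Summable fun p ↦ latChar a b p * ((‖latPt τ p‖ ^ (-2 * s) : ℝ) : ℂ) := by
  apply Summable.of_norm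
  simp_rw [norm_latChar_mul_ofReal]
  simpa using (summable_norm_latPt_rpow τ (r := 2 * s) (by linarith)).abs

/-- The lattice sum is the sum over the row of the origin plus the sum over the other rows. -/
lemma latSum_eq (τ : ℍ) (a b : ℝ) {s : ℝ} (hs : 1 < s) :
    latSum τ a b s = ∑' n : ℤ, latChar a b (0, n) * ((|(n : ℝ)| ^ (-2 * s) : ℝ) : ℂ)
      + ∑' p, latChar a b p * (rowsTerm τ s p 0 : ℂ) := by
  have h1 := summable_latChar_mul τ a b hs
  have h2 : Summable fun p ↦ latChar a b p * (rowsTerm τ s p 0 : ℂ) := by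
    apply Summable.of_norm
    simp_rw [norm_latChar_mul_ofReal]
    exact (summable_rowsTerm τ hs).abs
  rw [← sub_eq_iff_eq_add, latSum, ← h1.tsum_sub h2]
  have hinj : Function.Injective fun n : ℤ ↦ ((0, n) : ℤ × ℤ) := fun m n h ↦ by simpa using h
  rw [← hinj.tsum_eq]
  · congr 1 with n
    simp [rowsTerm, latPt]
  · intro p hp
    by_cases h0 : p.1 = 0
    · exact ⟨p.2, by rw [← h0]⟩
    · simp [rowsTerm, h0] at hp

lemma abs_int_rpow_le (n : ℤ) {s : ℝ} (hs : 1 < s) : |(n : ℝ)| ^ (-2 * s) ≤ 1 / (n : ℝ) ^ 2 := by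
  rcases eq_or_ne n 0 with rfl | hn
  · rw [Int.cast_zero, abs_zero, Real.zero_rpow (by linarith)]
    simp
  · have h : (1 : ℝ) ≤ |(n : ℝ)| := by exact_mod_cast Int.one_le_abs hn
    refine (Real.rpow_le_rpow_of_exponent_le h (by linarith : -2 * s ≤ -2)).trans_eq ?_
    rw [Real.rpow_neg (abs_nonneg _), show (2 : ℝ) = (2 : ℕ) by norm_num, Real.rpow_natCast, sq_abs,
      one_div]

/-- The limit of the row of the origin, in terms of the second Bernoulli polynomial. -/
lemma tendsto_tsum_zero_row (a : ℝ) {b : ℝ} (hb : b ∈ Set.Icc (0 : ℝ) 1) :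
    Tendsto (fun s : ℝ ↦ ∑' n : ℤ, latChar a b (0, n) * ((|(n : ℝ)| ^ (-2 * s) : ℝ) : ℂ)) (𝓝[>] 1)
      (𝓝 ((2 * π ^ 2 * (b ^ 2 - b + 1 / 6) : ℝ) : ℂ)) := by
  have hval : HasSum (fun n : ℤ ↦ latChar a b (0, n) * ((|(n : ℝ)| ^ (-2 * (1 : ℝ)) : ℝ) : ℂ))
      ((2 * π ^ 2 * (b ^ 2 - b + 1 / 6) : ℝ) : ℂ) := by
    have h := hasSum_one_div_pow_mul_fourier_mul_bernoulliFun le_rfl hb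
    rw [← (Equiv.neg ℤ).hasSum_iff] at h
    convert! h using 1
    · ext n
      have hf : (fourier (-n) (b : UnitAddCircle) : ℂ) = latChar a b (0, n) := by
        refine fourier_coe_apply.trans ?_
        simp [latChar]
        ring_nf
      rw [Function.comp_apply, Equiv.neg_apply, hf, mul_comm, mul_one, Real.rpow_neg (abs_nonneg _),
        show (2 : ℝ) = (2 : ℕ) by norm_num, Real.rpow_natCast, sq_abs]
      push_cast
      rw [neg_sq, one_div]
    · rw [bernoulliFun_two, mul_pow, I_sq]
      push_cast [Nat.factorial]
      ring
  rw [← hval.tsum_eq]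
  refine tendsto_tsum_of_dominated_convergence (Real.summable_one_div_int_pow.mpr one_lt_two)
    (fun n ↦ ?_) ?_
  · refine ((continuous_ofReal.tendsto _).comp ?_).const_mul _
    refine Tendsto.mono_left ?_ nhdsWithin_le_nhds
    rcases eq_or_ne n 0 with rfl | hn
    · refine tendsto_const_nhds.congr' ?_
      filter_upwards [eventually_gt_nhds (zero_lt_one (α := ℝ))] with s hs
      rw [Int.cast_zero, abs_zero, Real.zero_rpow (mul_neg_of_neg_of_pos (by norm_num) hs).ne,
        Real.zero_rpow (by norm_num)]
    · refine ContinuousAt.tendsto ((Real.continuousAt_const_rpow ?_).comp (by fun_prop))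
      simpa using hn
  · filter_upwards [self_mem_nhdsWithin] with s hs n
    rw [norm_latChar_mul_ofReal, abs_of_nonneg (by positivity)]
    exact abs_int_rpow_le n hs

lemma norm_exp_two_pi_I_mul_lt_one {w : ℂ} (hw : 0 < w.im) : ‖cexp (2 * π * I * w)‖ < 1 := by
  rw [norm_exp_two_pi_I_mul, Real.exp_lt_one_iff]
  have := mul_pos Real.pi_pos hw
  linarith

/-- A sum over `ℤ` is computed from the sums of opposite terms. -/
lemma tsum_int_eq_of_hasSum_nat {f : ℤ → ℂ} (hf : Summable f) (h0 : f 0 = 0) {g : ℕ → ℂ} {x : ℂ}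
    (hg : HasSum g x) (hg0 : g 0 = 0) (h : ∀ m : ℕ, m ≠ 0 → f m + f (-m) = g m) :
    ∑' m, f m = x := by
  have h1 := hf.hasSum.nat_add_neg
  rw [h0, add_zero] at h1
  refine h1.unique (hg.congr_fun fun m ↦ ?_)
  rcases eq_or_ne m 0 with rfl | hm
  · simp [h0, hg0]
  · exact h m hm

/-- The limit of the lattice sum at `s = 1` for a character which is nontrivial on the rows. -/
lemma tendsto_latSum (τ : ℍ) (a : ℝ) {b : ℝ} (hb : b ∈ Set.Ioo (0 : ℝ) 1) :
    Tendsto (fun s : ℝ ↦ latSum τ a b s) (𝓝[>] 1)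
      (𝓝 ((2 * π ^ 2 * (b ^ 2 - b + 1 / 6) - 2 * π / τ.im *
        (Real.log ‖qProd (nome τ) (cexp (2 * π * I * (b * τ + a)))‖
          + Real.log ‖qProd (nome τ) (cexp (2 * π * I * ((1 - b) * τ - a)))‖) : ℝ) : ℂ)) := by
  have hb1 : cexp (2 * π * I * b) ≠ 1 := by
    intro h
    obtain ⟨n, hn⟩ := Complex.exp_eq_one_iff.mp h
    have h2 : (b : ℂ) = n := mul_left_cancel₀ two_pi_I_ne_zero (by rw [hn]; ring)
    have h3 : b = n := by exact_mod_cast h2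
    have h4 := hb.1
    have h5 := hb.2
    rw [h3] at h4 h5
    have h6 : 0 < n := by exact_mod_cast h4
    have h7 : n < 1 := by exact_mod_cast h5
    omega
  obtain ⟨hsum, hlim⟩ := tendsto_tsum_rowsTerm τ a hb1
  have hU : ‖cexp (2 * π * I * (b * τ + a))‖ < 1 :=
    norm_exp_two_pi_I_mul_lt_one (by simpa using mul_pos hb.1 τ.im_pos)
  have hV : ‖cexp (2 * π * I * ((1 - b) * τ - a))‖ < 1 := by
    refine norm_exp_two_pi_I_mul_lt_one ?_
    have := mul_pos (sub_pos.mpr hb.2) τ.im_pos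
    simpa using this
  have hlog := ((log_norm_qProd (norm_nome_lt_one τ) hU).add
    (log_norm_qProd (norm_nome_lt_one τ) hV)).mul_left (2 * π / τ.im)
  have hval := tsum_int_eq_of_hasSum_nat hsum (if_pos rfl) (hasSum_ofReal.mpr hlog) (by simp)
    fun m hm ↦ by
      rw [if_neg (by simpa using hm), if_neg (by simpa using hm)]
      exact rowSum_add_rowSum_neg τ a ⟨hb.1.le, hb.2⟩ hm
  rw [hval] at hlim
  have h := (tendsto_tsum_zero_row a ⟨hb.1.le, hb.2.le⟩).add hlim
  rw [← ofReal_add] at h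
  refine (h.congr' ?_).trans_eq ?_
  · filter_upwards [self_mem_nhdsWithin] with s hs using (latSum_eq τ a b hs).symm
  · congr 2
    ring

/-! ### The limit `s → 1` of the lattice sum, trivial character -/

/-- The integral `∫ (1 + u²)^(-s) du`. -/
lemma integral_one_add_sq_rpow {s : ℝ} (hs : 1 / 2 < s) :
    ∫ u : ℝ, (1 + u ^ 2) ^ (-s) = √π * Real.Gamma (s - 1 / 2) / Real.Gamma s := by
  have hG : 0 < Real.Gamma s := Real.Gamma_pos_of_pos (by linarith)
  rw [eq_div_iff hG.ne', ← integral_mul_const]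
  have h1 (u : ℝ) : (1 + u ^ 2) ^ (-s) * Real.Gamma s
      = ∫ t in Set.Ioi (0 : ℝ), t ^ (s - 1) * Real.exp (-((1 + u ^ 2) * t)) := by
    rw [Real.integral_rpow_mul_exp_neg_mul_Ioi (by linarith) (by positivity), one_div,
      Real.inv_rpow (by positivity), Real.rpow_neg (by positivity)]
  have h2 (t : ℝ) (ht : t ∈ Set.Ioi (0 : ℝ)) :
      ∫ u : ℝ, t ^ (s - 1) * Real.exp (-((1 + u ^ 2) * t))
        = √π * (t ^ (s - 1 / 2 - 1) * Real.exp (-(1 * t))) := by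
    have ht : 0 < t := ht
    calc _ = ∫ u : ℝ, t ^ (s - 1) * Real.exp (-t) * Real.exp (-t * u ^ 2) := by
          congr 1 with u
          rw [mul_assoc, ← Real.exp_add]
          ring_nf
      _ = _ := by
          rw [integral_const_mul, integral_gaussian, Real.sqrt_div Real.pi_pos.le,
            Real.sqrt_eq_rpow t, show s - 1 / 2 - 1 = (s - 1) - 1 / 2 by ring, Real.rpow_sub ht _ (1 / 2)]
          ring_nf
  have hint : Integrable (Function.uncurry fun (u t : ℝ) ↦ t ^ (s - 1) *
      Real.exp (-((1 + u ^ 2) * t))) (volume.prod (volume.restrict (Set.Ioi 0))) := by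
    have hmeas : AEStronglyMeasurable (Function.uncurry fun (u t : ℝ) ↦ t ^ (s - 1) *
        Real.exp (-((1 + u ^ 2) * t))) (volume.prod (volume.restrict (Set.Ioi 0))) := by
      apply Measurable.aestronglyMeasurable
      unfold Function.uncurry
      fun_prop
    rw [integrable_prod_iff' hmeas]
    constructor
    · filter_upwards [ae_restrict_mem measurableSet_Ioi] with t ht
      have h := ((integrable_exp_neg_mul_sq ht).const_mul (t ^ (s - 1) * Real.exp (-t)))
      refine h.congr (Eventually.of_forall fun u ↦ ?_)
      simp only [Function.uncurry]
      rw [mul_assoc, ← Real.exp_add]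
      ring_nf
    · have h := (integrableOn_rpow_mul_exp_neg_mul_rpow (p := 1) (s := s - 1 / 2 - 1) (b := 1)
        (by linarith) one_pos one_pos).const_mul √π
      refine h.congr ?_
      filter_upwards [ae_restrict_mem measurableSet_Ioi] with t ht
      have ht' : 0 < t := ht
      have e : ∫ u : ℝ, ‖Function.uncurry (fun (u t : ℝ) ↦ t ^ (s - 1) *
          Real.exp (-((1 + u ^ 2) * t))) (u, t)‖
          = ∫ u : ℝ, t ^ (s - 1) * Real.exp (-((1 + u ^ 2) * t)) := by
        congr 1 with u
        rw [Function.uncurry_apply_pair, Real.norm_of_nonneg (by positivity)]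
      rw [e, h2 t ht]
      simp
  simp_rw [h1]
  rw [integral_integral_swap hint, setIntegral_congr_fun measurableSet_Ioi h2, integral_const_mul,
    Real.integral_rpow_mul_exp_neg_mul_Ioi (by linarith) one_pos]
  simp

lemma integrable_one_add_sq_rpow {s : ℝ} (hs : 1 / 2 < s) :
    Integrable fun u : ℝ ↦ (1 + u ^ 2) ^ (-s) := by
  have h := integrable_rpow_neg_one_add_norm_sq (E := ℝ) (μ := volume) (r := 2 * s)
    (by simp; linarith)
  refine h.congr (Eventually.of_forall fun u ↦ ?_)
  simp only [Real.norm_eq_abs, sq_abs]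
  ring_nf

lemma norm_latPt_add_rpow (τ : ℍ) {m : ℤ} (hm : m ≠ 0) (s u : ℝ) :
    ‖latPt τ (m, 0) + u‖ ^ (-2 * s) = (|(m : ℝ)| * τ.im) ^ (-2 * s) *
      (1 + ((u + m * τ.re) / (|(m : ℝ)| * τ.im)) ^ 2) ^ (-s) := by
  have hm' : 0 < |(m : ℝ)| * τ.im := mul_pos (by simpa using hm) τ.im_pos
  have h : ‖latPt τ (m, 0) + u‖ ^ 2 = (|(m : ℝ)| * τ.im) ^ 2 *
      (1 + ((u + m * τ.re) / (|(m : ℝ)| * τ.im)) ^ 2) := by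
    rw [mul_add, ← mul_pow, mul_div_cancel₀ _ hm'.ne', ← normSq_eq_norm_sq, normSq_apply, mul_pow,
      sq_abs]
    simp [latPt]
    ring
  have hx (x : ℝ) (hx : 0 ≤ x) : x ^ (-2 * s) = (x ^ 2) ^ (-s) := by
    rw [← Real.rpow_natCast, ← Real.rpow_mul hx]
    norm_num
  rw [hx _ (norm_nonneg _), h, hx _ hm'.le, Real.mul_rpow (by positivity) (by positivity)]

lemma integrable_norm_latPt_add_rpow (τ : ℍ) {m : ℤ} (hm : m ≠ 0) {s : ℝ} (hs : 1 / 2 < s) :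
    Integrable fun u : ℝ ↦ ‖latPt τ (m, 0) + u‖ ^ (-2 * s) := by
  have hm' : 0 < |(m : ℝ)| * τ.im := mul_pos (by simpa using hm) τ.im_pos
  simp_rw [norm_latPt_add_rpow τ hm]
  exact (((integrable_one_add_sq_rpow hs).comp_div hm'.ne').comp_add_right (m * τ.re)).const_mul _

lemma integral_norm_latPt_add_rpow (τ : ℍ) {m : ℤ} (hm : m ≠ 0) {s : ℝ} (hs : 1 / 2 < s) :
    ∫ u : ℝ, ‖latPt τ (m, 0) + u‖ ^ (-2 * s) = (|(m : ℝ)| * τ.im) ^ (1 - 2 * s) *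
      (√π * Real.Gamma (s - 1 / 2) / Real.Gamma s) := by
  have hm' : 0 < |(m : ℝ)| * τ.im := mul_pos (by simpa using hm) τ.im_pos
  simp_rw [norm_latPt_add_rpow τ hm]
  rw [integral_const_mul, integral_add_right_eq_self (μ := volume)
    (fun u : ℝ ↦ (1 + (u / (|(m : ℝ)| * τ.im)) ^ 2) ^ (-s)) (m * τ.re),
    Measure.integral_comp_div (fun u : ℝ ↦ (1 + u ^ 2) ^ (-s)) (|(m : ℝ)| * τ.im),
    integral_one_add_sq_rpow hs, abs_of_pos hm', smul_eq_mul, ← mul_assoc,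
    show 1 - 2 * s = -2 * s + 1 by ring, Real.rpow_add hm', Real.rpow_one]

/-- The defect between a term of the lattice sum and the integral over the adjacent segment. -/
def rowsDefect (τ : ℍ) (s : ℝ) (p : ℤ × ℤ) : ℝ :=
  rowsTerm τ s p 0 - ∫ u in (0 : ℝ)..1, rowsTerm τ s p u

lemma continuous_rowsTerm (τ : ℍ) (s : ℝ) (p : ℤ × ℤ) : Continuous (rowsTerm τ s p) := by
  unfold rowsTerm
  split_ifs with hp
  · exact continuous_const
  · refine Continuous.rpow_const (by fun_prop) fun u ↦ Or.inl ?_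
    exact (τ.im_pos.trans_le (im_le_norm_latPt_add τ hp u)).ne'

lemma rowsDefect_eq (τ : ℍ) (s : ℝ) (p : ℤ × ℤ) :
    rowsDefect τ s p = ∫ u in (0 : ℝ)..1, (rowsTerm τ s p 0 - rowsTerm τ s p u) := by
  rw [intervalIntegral.integral_sub (by simp)
    ((continuous_rowsTerm τ s p).intervalIntegrable _ _)]
  simp [rowsDefect]

lemma exists_abs_rowsDefect_le (τ : ℍ) : ∃ C : ℝ, ∀ (s : ℝ) (p : ℤ × ℤ),
    s ∈ Set.Icc (1 : ℝ) 2 → |rowsDefect τ s p| ≤ C * ‖latPt τ p‖ ^ (-3 : ℝ) := by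
  obtain ⟨C, hC⟩ := exists_abs_rowsTerm_sub_le τ
  refine ⟨C, fun s p hs ↦ ?_⟩
  rw [rowsDefect_eq, ← Real.norm_eq_abs]
  have h := intervalIntegral.norm_integral_le_of_norm_le_const (a := (0 : ℝ)) (b := 1)
    (C := C * ‖latPt τ p‖ ^ (-3 : ℝ)) (f := fun u ↦ rowsTerm τ s p 0 - rowsTerm τ s p u)
    fun u hu ↦ ?_
  · simpa using h
  · rw [Set.uIoc_of_le zero_le_one] at hu
    rw [Real.norm_eq_abs, abs_sub_comm]
    exact hC s p u hs ⟨hu.1.le, hu.2⟩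

lemma tendsto_rowsDefect (τ : ℍ) (p : ℤ × ℤ) :
    Tendsto (fun s ↦ rowsDefect τ s p) (𝓝[>] 1) (𝓝 (rowsDefect τ 1 p)) := by
  obtain ⟨C, hC⟩ := exists_abs_rowsTerm_sub_le τ
  simp_rw [rowsDefect_eq]
  refine intervalIntegral.tendsto_integral_filter_of_dominated_convergence
    (fun _ ↦ C * ‖latPt τ p‖ ^ (-3 : ℝ)) ?_ ?_ (by simp) ?_
  · exact Eventually.of_forall fun s ↦
      (continuous_const.sub (continuous_rowsTerm τ s p)).aestronglyMeasurable
  · filter_upwards [Ioc_mem_nhdsGT (one_lt_two (α := ℝ))] with s hs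
    refine Eventually.of_forall fun u hu ↦ ?_
    rw [Set.uIoc_of_le zero_le_one] at hu
    rw [Real.norm_eq_abs, abs_sub_comm]
    exact hC s p u ⟨hs.1.le, hs.2⟩ ⟨hu.1.le, hu.2⟩
  · exact Eventually.of_forall fun u _ ↦ (tendsto_rowsTerm τ p 0).sub (tendsto_rowsTerm τ p u)

/-- The integrals over the segments of a row add up to the integral over the line. -/
lemma hasSum_integral_rowsTerm (τ : ℍ) {s : ℝ} (hs : 1 / 2 < s) {m : ℤ} (hm : m ≠ 0) :
    HasSum (fun n : ℤ ↦ ∫ u in (0 : ℝ)..1, rowsTerm τ s (m, n) u)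
      ((|(m : ℝ)| * τ.im) ^ (1 - 2 * s) * (√π * Real.Gamma (s - 1 / 2) / Real.Gamma s)) := by
  have h := (integrable_norm_latPt_add_rpow τ hm hs).hasSum_intervalIntegral_comp_add_int
  rw [integral_norm_latPt_add_rpow τ hm hs] at h
  refine h.congr_fun fun n ↦ ?_
  congr 1 with u
  simp only [rowsTerm, hm, if_false, latPt]
  congr 2
  push_cast
  ring

/-- The integral `∫ (1 + u²)^(-s) du` in terms of the Gamma function; it is the factor of
`(|m| Im τ) ^ (1 - 2s)` in the integral over the row `m`. -/
def gammaFactor (s : ℝ) : ℝ := √π * Real.Gamma (s - 1 / 2) / Real.Gamma s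

lemma latChar_zero (p : ℤ × ℤ) : latChar 0 0 p = 1 := by simp [latChar]

lemma hasSum_rowsDefect_row (τ : ℍ) {s : ℝ} (hs : 1 / 2 < s) {m : ℤ}
    (h : Summable fun n ↦ rowsTerm τ s (m, n) 0) :
    HasSum (fun n ↦ rowsDefect τ s (m, n))
      (∑' n, rowsTerm τ s (m, n) 0 - (|(m : ℝ)| * τ.im) ^ (1 - 2 * s) * gammaFactor s) := by
  rcases eq_or_ne m 0 with rfl | hm
  · have h0 : (1 - 2 * s) ≠ 0 := by linarith
    simp [rowsDefect, rowsTerm, Real.zero_rpow h0]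
  · exact h.hasSum.sub (hasSum_integral_rowsTerm τ hs hm)

lemma summable_abs_mul_rpow (τ : ℍ) {s : ℝ} (hs : 1 < s) :
    Summable fun m : ℤ ↦ (|(m : ℝ)| * τ.im) ^ (1 - 2 * s) := by
  have h := (Real.summable_abs_int_rpow (b := 2 * s - 1) (by linarith)).mul_right
    (τ.im ^ (1 - 2 * s))
  refine h.congr fun m ↦ ?_
  rw [Real.mul_rpow (abs_nonneg _) τ.im_pos.le, neg_sub]

/-- The limit of the sum of the differences between the lattice sum over the rows other than that
of the origin and the corresponding integrals. -/
lemma tendsto_tsum_rowsTerm_sub (τ : ℍ) :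
    Tendsto (fun s : ℝ ↦ ∑' p, rowsTerm τ s p 0
      - (∑' m : ℤ, (|(m : ℝ)| * τ.im) ^ (1 - 2 * s)) * gammaFactor s) (𝓝[>] 1)
      (𝓝 (-(4 * π / τ.im) * Real.log ‖qProd (nome τ) (nome τ)‖)) := by
  obtain ⟨C, hC⟩ := exists_abs_rowsDefect_le τ
  have hsum3 : Summable fun p ↦ C * ‖latPt τ p‖ ^ (-3 : ℝ) :=
    (summable_norm_latPt_rpow τ (by norm_num)).mul_left C
  have hlim : Tendsto (fun s : ℝ ↦ ∑' p, rowsDefect τ s p) (𝓝[>] 1)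
      (𝓝 (∑' p, rowsDefect τ 1 p)) := by
    refine tendsto_tsum_of_dominated_convergence hsum3 (tendsto_rowsDefect τ) ?_
    filter_upwards [Ioc_mem_nhdsGT (one_lt_two (α := ℝ))] with s hs p
    exact hC s p ⟨hs.1.le, hs.2⟩
  have hsd (s : ℝ) (hs : s ∈ Set.Icc (1 : ℝ) 2) : Summable (rowsDefect τ s) :=
    hsum3.of_norm_bounded fun p ↦ hC s p hs
  have hval : ∑' p, rowsDefect τ 1 p
      = -(4 * π / τ.im) * Real.log ‖qProd (nome τ) (nome τ)‖ := by
    have hrow (m : ℤ) : Summable fun n ↦ rowsTerm τ 1 (m, n) 0 := by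
      have h := summable_rowsTerm_row τ 0 0 m
      simp only [latChar_zero, one_mul] at h
      exact summable_ofReal.mp h
    have h1 (m : ℤ) := (hasSum_rowsDefect_row τ (by norm_num) (hrow m)).tsum_eq
    have hs1 := (hsd 1 (by norm_num))
    rw [hs1.tsum_prod]
    have hsm := hs1.prod
    simp_rw [h1] at hsm ⊢
    have hq := norm_nome_lt_one τ
    have hlog := (log_norm_qProd hq hq).mul_left (4 * π / τ.im)
    rw [← ofReal_inj, ofReal_tsum]
    refine (tsum_int_eq_of_hasSum_nat (summable_ofReal.mpr hsm) ?_ (hasSum_ofReal.mpr hlog)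
      (by simp) fun m hm ↦ ?_).trans ?_
    · simp [rowsTerm]
      left
      norm_num
    · have hm' : (m : ℂ) ≠ 0 := by exact_mod_cast hm
      have hreal (k : ℤ) (hk : k ≠ 0) :
          ((∑' n, rowsTerm τ 1 (k, n) 0 : ℝ) : ℂ) = rowSum τ 0 0 k := by
        have h := tsum_rowsTerm_one τ 0 0 k
        simp only [latChar_zero, one_mul, if_neg hk] at h
        rw [ofReal_tsum, h]
      have hg : gammaFactor 1 = π := by
        rw [gammaFactor, show (1 : ℝ) - 1 / 2 = 1 / 2 by norm_num, Real.Gamma_one_half_eq,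
          Real.Gamma_one, div_one, Real.mul_self_sqrt Real.pi_pos.le]
      have hpair := rowSum_add_rowSum_neg τ 0 (b := 0) (by simp) hm
      have hmz : (m : ℤ) ≠ 0 := by exact_mod_cast hm
      rw [ofReal_sub, ofReal_sub, hreal _ hmz, hreal _ (neg_ne_zero.mpr hmz), sub_add_sub_comm,
        hpair, hg]
      have hqm : 1 - nome τ ^ m ≠ 0 := by
        intro h
        have h2 : ‖nome τ ^ m‖ = 1 := by rw [← sub_eq_zero.mp h, norm_one]
        rw [norm_pow] at h2
        exact (pow_lt_one₀ (norm_nonneg _) hq hm).ne h2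
      have hU : cexp (2 * π * I * ((0 : ℝ) * τ + (0 : ℝ))) ^ m / (m * (1 - nome τ ^ m))
          = ((1 / m : ℝ) : ℂ) + nome τ ^ m / (m * (1 - nome τ ^ m)) := by
        rw [ofReal_zero, zero_mul, add_zero, mul_zero, Complex.exp_zero, one_pow]
        push_cast
        field_simp
        ring
      have hV : cexp (2 * π * I * ((1 - (0 : ℝ)) * τ - (0 : ℝ))) = nome τ := by
        rw [nome]
        simp
      rw [hU, hV, add_re, ofReal_re, ← ofReal_add, ← ofReal_sub, ofReal_inj]
      have hmR : (m : ℝ) ≠ 0 := by exact_mod_cast hm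
      have hy := τ.im_ne_zero
      push_cast
      rw [abs_neg, Nat.abs_cast, show (1 - 2 * 1 : ℝ) = -1 by norm_num, Real.rpow_neg_one]
      field_simp
      ring
    · rw [neg_mul, mul_neg]
  rw [← hval]
  refine hlim.congr' ?_
  filter_upwards [Ioc_mem_nhdsGT (one_lt_two (α := ℝ))] with s hs
  have h1 := summable_rowsTerm τ hs.1
  have h2 := hsd s ⟨hs.1.le, hs.2⟩
  have h3 (m : ℤ) := (hasSum_rowsDefect_row τ (by linarith [hs.1]) (h1.prod_factor m)).tsum_eq
  rw [h2.tsum_prod]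
  simp_rw [h3]
  rw [h1.prod.tsum_sub ((summable_abs_mul_rpow τ hs.1).mul_right _), h1.tsum_prod, tsum_mul_right]

lemma tsum_abs_int_rpow {t : ℝ} (ht : 1 < t) :
    ((∑' m : ℤ, |(m : ℝ)| ^ (-t) : ℝ) : ℂ) = 2 * riemannZeta t := by
  rw [ofReal_tsum]
  have hs : Summable fun m : ℤ ↦ ((|(m : ℝ)| ^ (-t) : ℝ) : ℂ) :=
    summable_ofReal.mpr (Real.summable_abs_int_rpow ht)
  have ht' : 1 < (t : ℂ).re := by simpa using ht
  have hz : HasSum (fun n : ℕ ↦ 2 * (1 / (n : ℂ) ^ (t : ℂ))) (2 * riemannZeta t) := by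
    rw [zeta_eq_tsum_one_div_nat_cpow ht']
    exact (Complex.summable_one_div_nat_cpow.mpr ht').hasSum.mul_left 2
  refine tsum_int_eq_of_hasSum_nat hs ?_ hz ?_ fun m hm ↦ ?_
  · simp [Real.zero_rpow (show -t ≠ 0 by linarith)]
  · have : (t : ℂ) ≠ 0 := by exact_mod_cast (by linarith : t ≠ 0)
    simp [this]
  · push_cast
    rw [abs_neg, Nat.abs_cast, Real.rpow_neg (Nat.cast_nonneg _), ofReal_inv,
      ofReal_cpow (Nat.cast_nonneg _)]
    push_cast
    ring

/-- The coefficient of `ζ(2s - 1)` in `Im τ / π` times the lattice sum, with `y = Im τ`. -/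
def zetaFactor (y s : ℝ) : ℝ := 2 / √π * (y ^ (2 - 2 * s) * (Real.Gamma (s - 1 / 2) / Real.Gamma s))

lemma zetaFactor_one (y : ℝ) : zetaFactor y 1 = 2 := by
  have h : √π ≠ 0 := by positivity
  rw [zetaFactor, show (1 : ℝ) - 1 / 2 = 1 / 2 by norm_num, Real.Gamma_one_half_eq, Real.Gamma_one]
  norm_num
  field_simp

lemma hasDerivAt_zetaFactor {y : ℝ} (hy : 0 < y) :
    HasDerivAt (zetaFactor y) (-4 * Real.log y - 4 * Real.log 2) 1 := by
  have h : √π ≠ 0 := by positivity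
  have h1 : HasDerivAt (fun s : ℝ ↦ y ^ (2 - 2 * s)) (-2 * Real.log y) 1 := by
    have h0 : HasDerivAt (fun s : ℝ ↦ 2 - 2 * s) (-2) 1 := by
      simpa using ((hasDerivAt_id (1 : ℝ)).const_mul 2).const_sub 2
    convert! h0.const_rpow hy using 1
    norm_num
    ring
  have h2 : HasDerivAt (fun s : ℝ ↦ Real.Gamma (s - 1 / 2))
      (-√π * (Real.eulerMascheroniConstant + 2 * Real.log 2)) 1 := by
    have h0 : HasDerivAt (fun s : ℝ ↦ s - 1 / 2) 1 1 := (hasDerivAt_id (1 : ℝ)).sub_const _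
    have hg : HasDerivAt Real.Gamma (-√π * (Real.eulerMascheroniConstant + 2 * Real.log 2))
        ((1 : ℝ) - 1 / 2) := by
      convert! Real.hasDerivAt_Gamma_one_half using 1
      norm_num
    have h := hg.comp 1 h0
    rw [mul_one] at h
    exact h
  have h3 := Real.hasDerivAt_Gamma_one
  have h4 := (h1.mul (h2.div h3 (by simp))).const_mul (2 / √π)
  convert! h4 using 1
  rw [show (1 : ℝ) - 1 / 2 = 1 / 2 by norm_num, Real.Gamma_one_half_eq, Real.Gamma_one]
  norm_num
  rw [Real.Gamma_one_half_eq]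
  field_simp
  ring

/-- The contribution of the subtracted integrals: the pole of `ζ(2s - 1)` meets the first order term
of its coefficient. -/
lemma tendsto_zetaFactor_mul_zeta {y : ℝ} (hy : 0 < y) :
    Tendsto (fun s : ℝ ↦ (zetaFactor y s : ℂ) * riemannZeta (2 * s - 1) - 1 / (s - 1)) (𝓝[>] 1)
      (𝓝 ((2 * Real.eulerMascheroniConstant - 2 * Real.log y - 2 * Real.log 2 : ℝ) : ℂ)) := by
  have hlin : Tendsto (fun s : ℝ ↦ 2 * s - 1) (𝓝[>] 1) (𝓝[>] 1) := by
    refine tendsto_nhdsWithin_of_tendsto_nhds_of_eventually_within _ ?_ ?_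
    · refine Tendsto.mono_left ?_ nhdsWithin_le_nhds
      exact Continuous.tendsto' (by fun_prop) _ _ (by norm_num)
    · filter_upwards [self_mem_nhdsWithin] with s hs
      have : 1 < s := hs
      show 1 < 2 * s - 1
      linarith
  have hz := ZetaAsymptotics.tendsto_riemannZeta_sub_one_div_nhds_right.comp hlin
  have hd := hasDerivAt_zetaFactor hy
  have hc : Tendsto (fun s : ℝ ↦ (zetaFactor y s : ℂ)) (𝓝[>] 1) (𝓝 ((2 : ℝ) : ℂ)) := by
    have h := hd.continuousAt.tendsto
    rw [zetaFactor_one] at h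
    exact (continuous_ofReal.tendsto _).comp (h.mono_left nhdsWithin_le_nhds)
  have hs : Tendsto (fun s : ℝ ↦ ((slope (zetaFactor y) 1 s / 2 : ℝ) : ℂ)) (𝓝[>] 1)
      (𝓝 (((-4 * Real.log y - 4 * Real.log 2) / 2 : ℝ) : ℂ)) := by
    refine (continuous_ofReal.tendsto _).comp ?_
    exact ((hasDerivAt_iff_tendsto_slope.mp hd).mono_left
      (nhdsWithin_mono _ fun x hx ↦ (Set.mem_Ioi.mp hx).ne')).div_const 2
  have h := (hc.mul hz).add hs
  refine (h.congr' ?_).trans_eq ?_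
  · filter_upwards [self_mem_nhdsWithin] with s hs
    have h1 : (s : ℂ) - 1 ≠ 0 := by
      have : s - 1 ≠ 0 := sub_ne_zero.mpr (ne_of_gt hs)
      exact_mod_cast this
    have h2 : (2 * (s : ℂ) - 1 - 1) = 2 * (s - 1) := by ring
    simp only [Function.comp_apply, slope_def_field, zetaFactor_one]
    push_cast
    rw [h2]
    field_simp
    ring
  · congr 1
    push_cast
    ring

/-- The limit formula for the lattice sum at `s = 1` with trivial character. -/
lemma tendsto_latSum_zero (τ : ℍ) :
    Tendsto (fun s : ℝ ↦ (τ.im / π : ℂ) * latSum τ 0 0 s - 1 / (s - 1)) (𝓝[>] 1)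
      (𝓝 ((π * τ.im / 3 - 4 * Real.log ‖qProd (nome τ) (nome τ)‖
        + (2 * Real.eulerMascheroniConstant - 2 * Real.log τ.im - 2 * Real.log 2) : ℝ) : ℂ)) := by
  have hy := τ.im_pos
  have h1 := tendsto_tsum_zero_row 0 (b := 0) (by simp)
  have h2 := (continuous_ofReal.tendsto _).comp (tendsto_tsum_rowsTerm_sub τ)
  have h3 := tendsto_zetaFactor_mul_zeta hy
  have h := ((h1.add h2).const_mul (τ.im / π : ℂ)).add h3
  refine (h.congr' ?_).trans_eq ?_
  · filter_upwards [self_mem_nhdsWithin] with s hs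
    have hs : 1 < s := hs
    have hm : ((∑' m : ℤ, (|(m : ℝ)| * τ.im) ^ (1 - 2 * s) : ℝ) : ℂ)
        = (τ.im ^ (1 - 2 * s) : ℝ) * (2 * riemannZeta (2 * s - 1)) := by
      have h0 := tsum_abs_int_rpow (t := 2 * s - 1) (by linarith)
      push_cast at h0
      rw [← h0, ← ofReal_tsum, ← ofReal_mul, ← tsum_mul_left]
      congr 2 with m
      rw [Real.mul_rpow (abs_nonneg _) hy.le, neg_sub, mul_comm]
    have hf : zetaFactor τ.im s = τ.im / π * (τ.im ^ (1 - 2 * s) * 2 * gammaFactor s) := by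
      rw [zetaFactor, gammaFactor, show 2 - 2 * s = 1 + (1 - 2 * s) by ring, Real.rpow_add hy,
        Real.rpow_one]
      have h : √π ≠ 0 := by positivity
      have hsq : 2 / √π = 2 * √π / π := by
        rw [div_eq_div_iff h Real.pi_ne_zero, mul_assoc, Real.mul_self_sqrt Real.pi_pos.le]
      rw [hsq]
      ring
    rw [latSum_eq τ 0 0 hs, hf, Function.comp_apply, ofReal_sub, ofReal_mul _ (gammaFactor s), hm]
    simp only [latChar_zero, one_mul, ofReal_tsum]
    push_cast
    ring
  · rw [← ofReal_add, ← ofReal_div, ← ofReal_mul, ← ofReal_add]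
    congr 2
    have := Real.pi_ne_zero
    have := hy.ne'
    field_simp
    ring

/-! ### The theta function as a product -/

lemma summable_norm_pow_mul {q : ℂ} (hq : ‖q‖ < 1) (u : ℂ) :
    Summable fun n : ℕ ↦ ‖-(q ^ n * u)‖ := by
  simpa using (summable_geometric_of_lt_one (norm_nonneg _) hq).mul_right ‖u‖

lemma differentiable_qProd {q : ℂ} (hq : ‖q‖ < 1) : Differentiable ℂ (qProd q) := by
  intro u₀
  have hs : Summable fun n : ℕ ↦ ‖q‖ ^ n * (‖u₀‖ + 1) :=
    (summable_geometric_of_lt_one (norm_nonneg _) hq).mul_right _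
  have h := hs.hasProdLocallyUniformlyOn_nat_one_add (f := fun n (u : ℂ) ↦ -(q ^ n * u))
    (Metric.isOpen_ball (x := (0 : ℂ)) (ε := ‖u₀‖ + 1))
    (.of_forall fun n u hu ↦ by
      rw [norm_neg, norm_mul, norm_pow]
      gcongr
      simpa using (mem_ball_zero_iff.mp hu).le)
    (fun n ↦ by fun_prop)
  have h2 := h.differentiableOn (.of_forall fun s ↦ by
    simpa [Finset.prod_fn] using DifferentiableOn.finsetProd (fun _ _ ↦ by fun_prop))
    Metric.isOpen_ball
  have h3 := (h2 u₀ (by simp)).differentiableAt (Metric.isOpen_ball.mem_nhds (by simp))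
  refine h3.congr_of_eventuallyEq (.of_forall fun u ↦ ?_)
  simp [qProd, sub_eq_add_neg]

lemma qProd_eq_mul {q : ℂ} (hq : ‖q‖ < 1) (u : ℂ) : qProd q u = (1 - u) * qProd q (q * u) := by
  have hm : Multipliable fun n : ℕ ↦ 1 - q ^ (n + 1) * u := by
    simpa [sub_eq_add_neg, pow_succ, mul_assoc] using
      multipliable_one_add_of_summable (summable_norm_pow_mul hq (q * u))
  have h := tprod_eq_zero_mul' (f := fun n : ℕ ↦ 1 - q ^ n * u) hm
  simp only [pow_zero, one_mul, pow_succ, mul_assoc] at h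
  exact h

lemma qProd_eq_zero_iff {q : ℂ} (hq : ‖q‖ < 1) (u : ℂ) :
    qProd q u = 0 ↔ ∃ n : ℕ, q ^ n * u = 1 := by
  constructor
  · contrapose!
    intro h
    have := tprod_one_add_ne_zero_of_summable (f := fun n : ℕ ↦ -(q ^ n * u))
      (fun n h0 ↦ h n (by linear_combination -h0)) (summable_norm_pow_mul hq u)
    simpa [qProd, sub_eq_add_neg] using this
  · rintro ⟨n, hn⟩
    induction n generalizing u with
    | zero => rw [qProd_eq_mul hq u, show u = 1 by simpa using hn, sub_self, zero_mul]
    | succ n ih => rw [qProd_eq_mul hq u, ih (q * u) (by rw [← hn]; ring), mul_zero]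

/-- A theta function with simple zeros on `ℤτ + ℤ`, given by the Jacobi triple product and
multiplied by an exponential of a quadratic polynomial that makes it a reduced one. -/
def productTheta (τ : ℍ) (z : ℂ) : ℂ :=
  cexp (π / (2 * τ.im) * z ^ 2 - π * I * z) *
    (qProd (nome τ) (cexp (2 * π * I * z)) * qProd (nome τ) (cexp (2 * π * I * (τ - z))))

lemma differentiable_productTheta (τ : ℍ) : Differentiable ℂ (productTheta τ) := by
  have h := differentiable_qProd (norm_nome_lt_one τ)
  have h1 : Differentiable ℂ fun z : ℂ ↦ qProd (nome τ) (cexp (2 * π * I * z)) :=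
    h.comp (by fun_prop)
  have h2 : Differentiable ℂ fun z : ℂ ↦ qProd (nome τ) (cexp (2 * π * I * (τ - z))) :=
    h.comp (by fun_prop)
  unfold productTheta
  fun_prop

/-- The product with the factor that vanishes at the origin split off. -/
lemma productTheta_eq_mul (τ : ℍ) (z : ℂ) : productTheta τ z = (1 - cexp (2 * π * I * z)) *
    (cexp (π / (2 * τ.im) * z ^ 2 - π * I * z) *
    (qProd (nome τ) (cexp (2 * π * I * (τ + z))) *
      qProd (nome τ) (cexp (2 * π * I * (τ - z))))) := by
  rw [productTheta, qProd_eq_mul (norm_nome_lt_one τ) (cexp (2 * π * I * z)),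
    mul_add (2 * π * I) (τ : ℂ) z, Complex.exp_add, nome]
  ring

/-- `γ` is a quasi-period of `θ` with the factor of automorphy of a reduced theta function. -/
def IsQuasiPeriod (h : ℝ) (θ : ℂ → ℂ) (γ : ℂ) : Prop :=
  ∃ ψ : Circle, ∀ z : ℂ, θ (z + γ) = (ψ : ℂ) *
    cexp (π * (h * z * starRingEnd ℂ γ) + π / 2 * (h * γ * starRingEnd ℂ γ)) * θ z

lemma productTheta_add_one (τ : ℍ) : IsQuasiPeriod (1 / τ.im) (productTheta τ) 1 := by
  refine ⟨-1, fun z ↦ ?_⟩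
  have hy : (τ.im : ℂ) ≠ 0 := by exact_mod_cast τ.im_ne_zero
  have h1 : cexp (2 * π * I * (z + 1)) = cexp (2 * π * I * z) := by
    rw [mul_add, mul_one, Complex.exp_add, Complex.exp_two_pi_mul_I, mul_one]
  have h2 : cexp (2 * π * I * (τ - (z + 1))) = cexp (2 * π * I * (τ - z)) := by
    rw [show 2 * π * I * (τ - (z + 1)) = 2 * π * I * (τ - z) - 2 * π * I by ring, Complex.exp_sub,
      Complex.exp_two_pi_mul_I, div_one]
  have h3 : cexp (π / (2 * τ.im) * (z + 1) ^ 2 - π * I * (z + 1)) =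
      -cexp (π * (((1 / τ.im : ℝ) : ℂ) * z * 1) + π / 2 * (((1 / τ.im : ℝ) : ℂ) * 1 * 1)) *
        cexp (π / (2 * τ.im) * z ^ 2 - π * I * z) := by
    rw [neg_mul, ← Complex.exp_add, ← neg_one_mul, ← Complex.exp_neg_pi_mul_I, ← Complex.exp_add]
    congr 1
    push_cast
    field_simp
    ring
  simp only [productTheta, h1, h2, h3, map_one]
  simp
  ring

lemma productTheta_add_tau (τ : ℍ) : IsQuasiPeriod (1 / τ.im) (productTheta τ) τ := by
  refine ⟨-1, fun z ↦ ?_⟩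
  have hy : (τ.im : ℂ) ≠ 0 := by exact_mod_cast τ.im_ne_zero
  have hc : (τ : ℂ) = starRingEnd ℂ (τ : ℂ) + 2 * I * τ.im := by
    apply Complex.ext <;> simp <;> ring
  have h2 : cexp (2 * π * I * (τ - (z + τ))) = cexp (-(2 * π * I * z)) := by
    congr 1
    ring
  have h3 : nome τ * cexp (-(2 * π * I * z)) = cexp (2 * π * I * (τ - z)) := by
    rw [nome, ← Complex.exp_add]
    congr 1
    ring
  have h4 : 1 - cexp (-(2 * π * I * z)) =
      -cexp (-(2 * π * I * z)) * (1 - cexp (2 * π * I * z)) := by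
    rw [mul_sub, neg_mul, neg_mul, ← Complex.exp_add]
    simp
    ring
  have h5 : cexp (π / (2 * τ.im) * (z + τ) ^ 2 - π * I * (z + τ)) * cexp (-(2 * π * I * z)) =
      cexp (π * (((1 / τ.im : ℝ) : ℂ) * z * starRingEnd ℂ (τ : ℂ)) +
        π / 2 * (((1 / τ.im : ℝ) : ℂ) * τ * starRingEnd ℂ (τ : ℂ))) *
        cexp (π / (2 * τ.im) * z ^ 2 - π * I * z) := by
    rw [← Complex.exp_add, ← Complex.exp_add]
    congr 1
    push_cast
    generalize starRingEnd ℂ (τ : ℂ) = t at hc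
    field_simp
    linear_combination (2 * z + (τ : ℂ)) * hc
  rw [productTheta_eq_mul τ z, productTheta, h2,
    qProd_eq_mul (norm_nome_lt_one τ) (cexp (-(2 * π * I * z))), h3, h4, add_comm (τ : ℂ) z]
  push_cast at h5 ⊢
  linear_combination (-(1 - cexp (2 * π * I * z)) * qProd (nome τ) (cexp (2 * π * I * (z + τ))) *
      qProd (nome τ) (cexp (2 * π * I * (τ - z)))) * h5

lemma productTheta_eq_zero_iff (τ : ℍ) (z : ℂ) :
    productTheta τ z = 0 ↔ ∃ p, z = latPt τ p := by
  have key (n : ℕ) (w : ℂ) : nome τ ^ n * cexp (2 * π * I * w) = 1 ↔ ∃ k : ℤ, n * (τ : ℂ) + w = k := by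
    rw [nome, ← Complex.exp_nat_mul, ← Complex.exp_add, Complex.exp_eq_one_iff]
    refine exists_congr fun k ↦ ?_
    have : (2 * π * I : ℂ) ≠ 0 := by simp [Real.pi_ne_zero]
    rw [show n * (2 * π * I * τ) + 2 * π * I * w = (n * τ + w) * (2 * π * I) by ring,
      mul_left_inj' this]
  simp only [productTheta, mul_eq_zero, Complex.exp_ne_zero, false_or,
    qProd_eq_zero_iff (norm_nome_lt_one τ), key]
  constructor
  · rintro (⟨n, k, h⟩ | ⟨n, k, h⟩)
    · exact ⟨(-n, k), by simp [latPt]; linear_combination h⟩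
    · exact ⟨(n + 1, -k), by simp [latPt]; linear_combination -h⟩
  · rintro ⟨⟨m, k⟩, rfl⟩
    rcases le_or_gt m 0 with hm | hm
    · obtain ⟨n, hn⟩ := Int.eq_ofNat_of_zero_le (neg_nonneg.mpr hm)
      refine .inl ⟨n, k, ?_⟩
      have : (n : ℂ) = -m := by exact_mod_cast hn.symm
      simp [latPt, this]
    · obtain ⟨n, hn⟩ := Int.eq_ofNat_of_zero_le (show 0 ≤ m - 1 by lia)
      refine .inr ⟨n, -k, ?_⟩
      have : (n : ℂ) = m - 1 := by exact_mod_cast hn.symm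
      simp [latPt, this]
      ring

lemma qProd_nome_ne_zero (τ : ℍ) : qProd (nome τ) (nome τ) ≠ 0 := by
  rw [Ne, qProd_eq_zero_iff (norm_nome_lt_one τ)]
  rintro ⟨n, hn⟩
  have h : ‖nome τ ^ n * nome τ‖ < 1 := by
    rw [← pow_succ, norm_pow]
    exact pow_lt_one₀ (norm_nonneg _) (norm_nome_lt_one τ) (by simp)
  rw [hn] at h
  simp at h

lemma deriv_productTheta_zero (τ : ℍ) :
    deriv (productTheta τ) 0 = -(2 * π * I) * qProd (nome τ) (nome τ) ^ 2 := by
  have hq := differentiable_qProd (norm_nome_lt_one τ)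
  set g : ℂ → ℂ := fun z ↦ cexp (π / (2 * τ.im) * z ^ 2 - π * I * z) *
    (qProd (nome τ) (cexp (2 * π * I * (τ + z))) * qProd (nome τ) (cexp (2 * π * I * (τ - z))))
    with hg
  have h1 : Differentiable ℂ g := by
    have h1 : Differentiable ℂ fun z : ℂ ↦ qProd (nome τ) (cexp (2 * π * I * (τ + z))) :=
      hq.comp (by fun_prop)
    have h2 : Differentiable ℂ fun z : ℂ ↦ qProd (nome τ) (cexp (2 * π * I * (τ - z))) :=
      hq.comp (by fun_prop)
    fun_prop
  have h2 : HasDerivAt (fun z : ℂ ↦ 1 - cexp (2 * π * I * z)) (-(2 * π * I)) 0 := by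
    have := (((hasDerivAt_id (0 : ℂ)).const_mul (2 * π * I)).cexp).const_sub 1
    simpa using this
  have h3 : productTheta τ = (fun z : ℂ ↦ 1 - cexp (2 * π * I * z)) * g :=
    funext (productTheta_eq_mul τ)
  rw [h3, (h2.mul (h1 0).hasDerivAt).deriv]
  simp [hg, nome]
  ring

lemma deriv_productTheta_zero_ne_zero (τ : ℍ) : deriv (productTheta τ) 0 ≠ 0 := by
  rw [deriv_productTheta_zero]
  simp [qProd_nome_ne_zero, Real.pi_ne_zero]

/-! ### Existence and uniqueness of the normalized theta function -/

lemma IsQuasiPeriod.add {h : ℝ} {θ : ℂ → ℂ} {γ δ : ℂ} (hγ : IsQuasiPeriod h θ γ)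
    (hδ : IsQuasiPeriod h θ δ) : IsQuasiPeriod h θ (γ + δ) := by
  obtain ⟨ψ, hψ⟩ := hγ
  obtain ⟨χ, hχ⟩ := hδ
  refine ⟨ψ * χ * Circle.exp (π * h * (γ * starRingEnd ℂ δ).im), fun z ↦ ?_⟩
  have him : ((γ * starRingEnd ℂ δ).im : ℂ) * I =
      (γ * starRingEnd ℂ δ - starRingEnd ℂ γ * δ) / 2 := by
    apply Complex.ext <;> simp <;> ring
  have hexp : cexp (π * (h * (z + γ) * starRingEnd ℂ δ) + π / 2 * (h * δ * starRingEnd ℂ δ)) *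
      cexp (π * (h * z * starRingEnd ℂ γ) + π / 2 * (h * γ * starRingEnd ℂ γ)) =
      cexp (((π * h * (γ * starRingEnd ℂ δ).im : ℝ) : ℂ) * I) *
        cexp (π * (h * z * starRingEnd ℂ (γ + δ)) +
          π / 2 * (h * (γ + δ) * starRingEnd ℂ (γ + δ))) := by
    rw [← Complex.exp_add, ← Complex.exp_add]
    congr 1
    push_cast
    rw [mul_assoc _ _ I, him, map_add]
    ring
  rw [← add_assoc, hχ, hψ, Circle.coe_mul, Circle.coe_mul, Circle.coe_exp]
  push_cast at hexp ⊢
  linear_combination (ψ * χ * θ z : ℂ) * hexp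

lemma IsQuasiPeriod.neg {h : ℝ} {θ : ℂ → ℂ} {γ : ℂ} (hγ : IsQuasiPeriod h θ γ) :
    IsQuasiPeriod h θ (-γ) := by
  obtain ⟨ψ, hψ⟩ := hγ
  refine ⟨ψ⁻¹, fun z ↦ ?_⟩
  have h1 := hψ (z + -γ)
  rw [neg_add_cancel_right] at h1
  have hexp : cexp (π * (h * z * starRingEnd ℂ (-γ)) + π / 2 * (h * -γ * starRingEnd ℂ (-γ))) *
      cexp (π * (h * (z + -γ) * starRingEnd ℂ γ) + π / 2 * (h * γ * starRingEnd ℂ γ)) = 1 := by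
    rw [← Complex.exp_add, Complex.exp_eq_one_iff]
    exact ⟨0, by rw [map_neg]; push_cast; ring⟩
  have hψ0 : (ψ : ℂ)⁻¹ * ψ = 1 := inv_mul_cancel₀ ψ.coe_ne_zero
  rw [h1, Circle.coe_inv]
  linear_combination (-(ψ : ℂ)⁻¹ * ψ * θ (z + -γ)) * hexp - θ (z + -γ) * hψ0

/-- The quasi-periods of a function, for a fixed Hermitian form, are a group. -/
def quasiPeriods (h : ℝ) (θ : ℂ → ℂ) : AddSubgroup ℂ where
  carrier := {γ | IsQuasiPeriod h θ γ}
  zero_mem' := ⟨1, fun z ↦ by simp⟩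
  add_mem' := IsQuasiPeriod.add
  neg_mem' := IsQuasiPeriod.neg

lemma IsQuasiPeriod.scale {h : ℝ} {θ : ℂ → ℂ} {γ : ℂ} (hγ : IsQuasiPeriod h θ γ) {ω : ℂ}
    (hω : ω ≠ 0) (c : ℂ) : IsQuasiPeriod (h / ‖ω‖ ^ 2) (fun z ↦ c * θ (z / ω)) (ω * γ) := by
  obtain ⟨ψ, hψ⟩ := hγ
  refine ⟨ψ, fun z ↦ ?_⟩
  have hω' : starRingEnd ℂ ω ≠ 0 := by simpa
  simp only
  rw [show (z + ω * γ) / ω = z / ω + γ by field_simp, hψ]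
  have hn : ((‖ω‖ : ℂ)) ^ 2 = ω * starRingEnd ℂ ω := (mul_conj' ω).symm
  push_cast
  rw [hn, map_mul, show (h / (ω * starRingEnd ℂ ω) * z * (starRingEnd ℂ ω * starRingEnd ℂ γ) : ℂ) =
    h * (z / ω) * starRingEnd ℂ γ by field_simp,
    show (h / (ω * starRingEnd ℂ ω) * (ω * γ) * (starRingEnd ℂ ω * starRingEnd ℂ γ) : ℂ) =
    h * γ * starRingEnd ℂ γ by field_simp]
  ring

/-- The absolute value of a reduced theta function, multiplied by the Gaussian of its Hermitian
form, is periodic. -/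
lemma IsQuasiPeriod.norm_mul_exp {h : ℝ} {θ : ℂ → ℂ} {γ : ℂ} (hγ : IsQuasiPeriod h θ γ) (z : ℂ) :
    ‖θ (z + γ)‖ * Real.exp (-(π / 2 * h * ‖z + γ‖ ^ 2)) =
      ‖θ z‖ * Real.exp (-(π / 2 * h * ‖z‖ ^ 2)) := by
  obtain ⟨ψ, hψ⟩ := hγ
  rw [hψ, norm_mul, norm_mul, Circle.norm_coe, one_mul, norm_exp, mul_right_comm, mul_comm,
    ← Real.exp_add]
  congr 2
  simp only [← normSq_eq_norm_sq, normSq_apply]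
  have h2 : (π / 2 : ℂ) = ((π / 2 : ℝ) : ℂ) := by push_cast; rfl
  rw [h2]
  simp
  ring

/-- `Γ = ω (ℤτ + ℤ)`. -/
structure IsSpannedBy (Γ : Submodule ℤ ℂ) (ω : ℂ) (τ : ℍ) : Prop where
  ne_zero : ω ≠ 0
  mem_iff : ∀ z, z ∈ Γ ↔ ∃ p, z = ω * latPt τ p

lemma exists_coordinates (τ : ℍ) {ω : ℂ} (hω : ω ≠ 0) (z : ℂ) :
    ∃ a b : ℝ, z = ω * (b * τ + a) := by
  have hy := τ.im_ne_zero
  refine ⟨(z / ω).re - (z / ω).im / τ.im * τ.re, (z / ω).im / τ.im, ?_⟩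
  have : z / ω = ((z / ω).im / τ.im : ℝ) * (τ : ℂ) +
      (((z / ω).re - (z / ω).im / τ.im * τ.re : ℝ) : ℂ) := by
    apply Complex.ext
    · simp
    · simp [hy]
  rw [← this]
  field_simp

lemma IsSpannedBy.isQuasiPeriod {Γ : Submodule ℤ ℂ} {ω : ℂ} {τ : ℍ} (hΓ : IsSpannedBy Γ ω τ)
    (c : ℂ) {γ : ℂ} (hγ : γ ∈ Γ) :
    IsQuasiPeriod (1 / τ.im / ‖ω‖ ^ 2) (fun z ↦ c * productTheta τ (z / ω)) γ := by
  obtain ⟨p, rfl⟩ := (hΓ.mem_iff γ).mp hγ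
  refine IsQuasiPeriod.scale ?_ hΓ.ne_zero c
  have h1 := (quasiPeriods (1 / τ.im) (productTheta τ)).zsmul_mem (productTheta_add_tau τ) p.1
  have h2 := (quasiPeriods (1 / τ.im) (productTheta τ)).zsmul_mem (productTheta_add_one τ) p.2
  have h3 := AddSubgroup.add_mem _ h1 h2
  simp only [zsmul_eq_mul, mul_one] at h3
  exact h3

/-- The normalized reduced theta function of `ω (ℤτ + ℤ)`. -/
def normalizedTheta (ω : ℂ) (τ : ℍ) (z : ℂ) : ℂ :=
  ω / deriv (productTheta τ) 0 * productTheta τ (z / ω)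

lemma IsSpannedBy.normalizedTheta_eq_zero_iff {Γ : Submodule ℤ ℂ} {ω : ℂ} {τ : ℍ}
    (hΓ : IsSpannedBy Γ ω τ) (z : ℂ) : normalizedTheta ω τ z = 0 ↔ z ∈ Γ := by
  have hω := hΓ.ne_zero
  rw [normalizedTheta, mul_eq_zero_iff_left (div_ne_zero hω (deriv_productTheta_zero_ne_zero τ)),
    productTheta_eq_zero_iff, hΓ.mem_iff]
  simp_rw [div_eq_iff hω, mul_comm ω]

lemma differentiable_normalizedTheta (ω : ℂ) (τ : ℍ) : Differentiable ℂ (normalizedTheta ω τ) :=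
  ((differentiable_productTheta τ).comp (by fun_prop : Differentiable ℂ fun z : ℂ ↦ z / ω)).const_mul
    _

lemma deriv_normalizedTheta_zero {ω : ℂ} (hω : ω ≠ 0) (τ : ℍ) :
    deriv (normalizedTheta ω τ) 0 = 1 := by
  have h0 : HasDerivAt (productTheta τ) (deriv (productTheta τ) 0) (0 / ω) := by
    rw [zero_div]
    exact (differentiable_productTheta τ 0).hasDerivAt
  have h1 := (h0.comp (0 : ℂ) ((hasDerivAt_id (0 : ℂ)).div_const ω)).const_mul
    (ω / deriv (productTheta τ) 0)
  refine h1.deriv.trans ?_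
  have := deriv_productTheta_zero_ne_zero τ
  field_simp

lemma IsQuasiPeriod.deriv_ne_zero {h : ℝ} {θ : ℂ → ℂ} {γ : ℂ} (hγ : IsQuasiPeriod h θ γ)
    (hθ : Differentiable ℂ θ) (h0 : θ 0 = 0) (h1 : deriv θ 0 ≠ 0) : deriv θ γ ≠ 0 := by
  obtain ⟨ψ, hψ⟩ := hγ
  set g : ℂ → ℂ := fun z ↦ (ψ : ℂ) *
    cexp (π * (h * z * starRingEnd ℂ γ) + π / 2 * (h * γ * starRingEnd ℂ γ)) with hg
  have hgd : Differentiable ℂ g := by fun_prop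
  have h2 : (fun z ↦ θ (z + γ)) = g * θ := funext hψ
  have h3 := deriv_comp_add_const θ γ 0
  rw [h2, ((hgd 0).hasDerivAt.mul (hθ 0).hasDerivAt).deriv, h0, mul_zero, zero_add, zero_add] at h3
  rw [← h3]
  exact mul_ne_zero (mul_ne_zero ψ.coe_ne_zero (Complex.exp_ne_zero _)) h1

theorem IsSpannedBy.isNormalizedTheta {Γ : Submodule ℤ ℂ} {ω : ℂ} {τ : ℍ}
    (hΓ : IsSpannedBy Γ ω τ) : IsNormalizedTheta Γ (normalizedTheta ω τ) where
  isReducedTheta :=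
    { entire := differentiable_normalizedTheta ω τ
      ne_zero := fun h ↦ by
        have := deriv_normalizedTheta_zero hΓ.ne_zero τ
        rw [h] at this
        simp at this
      transformation := by
        choose ψ hψ using fun γ : Γ ↦
          hΓ.isQuasiPeriod (ω / deriv (productTheta τ) 0) γ.2
        exact ⟨_, ψ, fun z γ ↦ hψ γ z⟩ }
  order_of_mem z hz := by
    refine ((differentiable_normalizedTheta ω τ).analyticAt z).analyticOrderAt_eq_one_of_zero_deriv_ne_zero
      ((hΓ.normalizedTheta_eq_zero_iff z).mpr hz) ?_
    refine (hΓ.isQuasiPeriod _ hz).deriv_ne_zero (differentiable_normalizedTheta ω τ)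
      ((hΓ.normalizedTheta_eq_zero_iff 0).mpr Γ.zero_mem) ?_
    change deriv (normalizedTheta ω τ) 0 ≠ 0
    simp [deriv_normalizedTheta_zero hΓ.ne_zero τ]
  ne_zero_of_notMem z hz := fun h ↦ hz ((hΓ.normalizedTheta_eq_zero_iff z).mp h)
  deriv_zero := deriv_normalizedTheta_zero hΓ.ne_zero τ

lemma IsSpannedBy.bddAbove_of_periodic {Γ : Submodule ℤ ℂ} {ω : ℂ} {τ : ℍ}
    (hΓ : IsSpannedBy Γ ω τ) {u : ℂ → ℝ} (hu : Continuous u)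
    (hper : ∀ γ ∈ Γ, ∀ z, u (z + γ) = u z) : ∃ C, ∀ z, u z ≤ C := by
  have hK : IsCompact ((fun x : ℝ × ℝ ↦ ω * (x.2 * (τ : ℂ) + x.1)) ''
      (Set.Icc 0 1 ×ˢ Set.Icc 0 1)) :=
    (isCompact_Icc.prod isCompact_Icc).image (by fun_prop)
  obtain ⟨C, hC⟩ := hK.bddAbove_image hu.continuousOn
  refine ⟨C, fun z ↦ ?_⟩
  obtain ⟨a, b, rfl⟩ := exists_coordinates τ hΓ.ne_zero z
  have h1 : ω * (b * (τ : ℂ) + a) = ω * ((Int.fract b : ℝ) * (τ : ℂ) + (Int.fract a : ℝ)) +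
      ω * latPt τ (⌊b⌋, ⌊a⌋) := by
    simp only [Int.fract, latPt]
    push_cast
    ring
  rw [h1, hper _ ((hΓ.mem_iff _).mpr ⟨_, rfl⟩)]
  refine hC ⟨_, ⟨(Int.fract a, Int.fract b), ?_, rfl⟩, rfl⟩
  exact ⟨⟨Int.fract_nonneg _, (Int.fract_lt_one _).le⟩, ⟨Int.fract_nonneg _, (Int.fract_lt_one _).le⟩⟩

/-- Two entire functions with the same zeros differ by a nowhere vanishing entire function. -/
lemma exists_entire_quotient {f g : ℂ → ℂ} (hf : Differentiable ℂ f) (hg : Differentiable ℂ g)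
    (hord : ∀ z, analyticOrderAt f z = analyticOrderAt g z) (htop : ∀ z, analyticOrderAt g z ≠ ⊤) :
    ∃ q : ℂ → ℂ, Differentiable ℂ q ∧ ∀ z, f z = q z * g z := by
  have hfm : MeromorphicOn f Set.univ := fun z _ ↦ (hf.analyticAt z).meromorphicAt
  have hgm : MeromorphicOn g Set.univ := fun z _ ↦ (hg.analyticAt z).meromorphicAt
  have hm : MeromorphicOn (f * g⁻¹) Set.univ := hfm.mul hgm.inv
  obtain ⟨q, hnf, heq⟩ : ∃ q : ℂ → ℂ, MeromorphicNFOn q Set.univ ∧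
      ∀ z, q =ᶠ[𝓝[≠] z] f * g⁻¹ :=
    ⟨toMeromorphicNFOn (f * g⁻¹) Set.univ, meromorphicNFOn_toMeromorphicNFOn _ _,
      fun z ↦ hm.toMeromorphicNFOn_eq_self_on_nhdsNE (Set.mem_univ z)⟩
  have hq (z : ℂ) : AnalyticAt ℂ q z := by
    rw [← (hnf (Set.mem_univ z)).meromorphicOrderAt_nonneg_iff_analyticAt,
      meromorphicOrderAt_congr (heq z),
      meromorphicOrderAt_mul (hfm z trivial) (hgm.inv z trivial), meromorphicOrderAt_inv,
      (hf.analyticAt z).meromorphicOrderAt_eq, (hg.analyticAt z).meromorphicOrderAt_eq, hord z]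
    obtain ⟨n, hn⟩ := ENat.ne_top_iff_exists.mp (htop z)
    rw [← hn]
    norm_cast
    simp
  refine ⟨q, fun z ↦ (hq z).differentiableAt, fun z ↦ ?_⟩
  have h1 : f =ᶠ[𝓝[≠] z] q * g := by
    have hne : ∀ᶠ w in 𝓝[≠] z, g w ≠ 0 := by
      refine (hg.analyticAt z).eventually_eq_zero_or_eventually_ne_zero.resolve_left fun h ↦ ?_
      exact htop z (analyticOrderAt_eq_top.mpr h)
    filter_upwards [hne, heq z] with w hw hw2
    rw [Pi.mul_apply, hw2]
    simp [hw]
  have h2 : ContinuousAt (q * g) z := ((hq z).continuousAt).mul (hg z).continuousAt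
  exact (hf z).continuousAt.eventuallyEq_nhds_iff_eventuallyEq_nhdsNE h2 |>.mp h1 |>.eq_of_nhds

lemma IsReducedTheta.exists_isQuasiPeriod {Γ : Submodule ℤ ℂ} {θ : ℂ → ℂ}
    (hθ : IsReducedTheta Γ θ) : ∃ h : ℝ, ∀ γ ∈ Γ, IsQuasiPeriod h θ γ := by
  obtain ⟨h, ψ, hψ⟩ := hθ.transformation
  exact ⟨h, fun γ hγ ↦ ⟨ψ ⟨γ, hγ⟩, fun z ↦ hψ z ⟨γ, hγ⟩⟩⟩

/-- The quotient of two normalized theta functions is entire, and bounded if the Hermitian form of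
the numerator is at most that of the denominator. -/
lemma IsSpannedBy.theta_eq_of_le {Γ : Submodule ℤ ℂ} {ω : ℂ} {τ : ℍ} (hΓ : IsSpannedBy Γ ω τ)
    {θ₁ θ₂ : ℂ → ℂ} (hθ₁ : IsNormalizedTheta Γ θ₁) (hθ₂ : IsNormalizedTheta Γ θ₂) {h₁ h₂ : ℝ}
    (hq₁ : ∀ γ ∈ Γ, IsQuasiPeriod h₁ θ₁ γ) (hq₂ : ∀ γ ∈ Γ, IsQuasiPeriod h₂ θ₂ γ)
    (hle : h₁ ≤ h₂) : θ₁ = θ₂ := by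
  have hd₁ := hθ₁.isReducedTheta.entire
  have hd₂ := hθ₂.isReducedTheta.entire
  have hord₀ {θ : ℂ → ℂ} (hθ : IsNormalizedTheta Γ θ) {z : ℂ} (hz : z ∉ Γ) :
      analyticOrderAt θ z = 0 :=
    (hθ.isReducedTheta.entire.analyticAt z).analyticOrderAt_eq_zero.mpr (hθ.ne_zero_of_notMem z hz)
  obtain ⟨q, hq, hmul⟩ := exists_entire_quotient hd₁ hd₂
    (fun z ↦ by
      by_cases hz : z ∈ Γ
      · rw [hθ₁.order_of_mem z hz, hθ₂.order_of_mem z hz]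
      · rw [hord₀ hθ₁ hz, hord₀ hθ₂ hz])
    (fun z ↦ by
      by_cases hz : z ∈ Γ
      · simp [hθ₂.order_of_mem z hz]
      · simp [hord₀ hθ₂ hz])
  set u : ℂ → ℝ := fun z ↦ ‖q z‖ * Real.exp (π / 2 * (h₂ - h₁) * ‖z‖ ^ 2) with hu
  have huc : Continuous u := by
    have := hq.continuous
    fun_prop
  have hu_eq {z : ℂ} (hz : z ∉ Γ) : u z = (‖θ₁ z‖ * Real.exp (-(π / 2 * h₁ * ‖z‖ ^ 2))) /
      (‖θ₂ z‖ * Real.exp (-(π / 2 * h₂ * ‖z‖ ^ 2))) := by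
    have h0 : ‖θ₂ z‖ ≠ 0 := norm_ne_zero_iff.mpr (hθ₂.ne_zero_of_notMem z hz)
    have he : Real.exp (π / 2 * (h₂ - h₁) * ‖z‖ ^ 2) =
        Real.exp (-(π / 2 * h₁ * ‖z‖ ^ 2)) / Real.exp (-(π / 2 * h₂ * ‖z‖ ^ 2)) := by
      rw [← Real.exp_sub]
      congr 1
      ring
    simp only [hu]
    rw [hmul z, norm_mul, he]
    field_simp
  -- A normalized theta function vanishes to order one on the lattice, so the lattice has no
  -- accumulation points.
  have hdense : Dense {z : ℂ | z ∉ Γ} := by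
    intro z
    rw [mem_closure_iff_frequently]
    by_cases hz : z ∈ Γ
    · have hne : ∀ᶠ w in 𝓝[≠] z, θ₂ w ≠ 0 := by
        refine (hd₂.analyticAt z).eventually_eq_zero_or_eventually_ne_zero.resolve_left fun h ↦ ?_
        have := hθ₂.order_of_mem z hz
        rw [analyticOrderAt_eq_top.mpr h] at this
        simp at this
      refine Frequently.filter_mono (Eventually.frequently (hne.mono fun w hw ↦ ?_))
        nhdsWithin_le_nhds
      exact fun hwΓ ↦ hw <| apply_eq_zero_of_analyticOrderAt_ne_zero (by simp [hθ₂.order_of_mem w hwΓ])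
    · exact fun h ↦ h.self_of_nhds hz
  have hper (γ : ℂ) (hγ : γ ∈ Γ) (z : ℂ) : u (z + γ) = u z := by
    have : (fun z ↦ u (z + γ)) = u := by
      refine Continuous.ext_on hdense (by fun_prop) huc fun w hw ↦ ?_
      have hw' : w + γ ∉ Γ := fun h ↦ hw (by simpa using Γ.sub_mem h hγ)
      rw [hu_eq hw', hu_eq hw, (hq₁ γ hγ).norm_mul_exp, (hq₂ γ hγ).norm_mul_exp]
    exact congrFun this z
  obtain ⟨C, hC⟩ := hΓ.bddAbove_of_periodic huc hper
  have hb : Bornology.IsBounded (Set.range q) := by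
    refine isBounded_iff_forall_norm_le.mpr ⟨C, ?_⟩
    rintro _ ⟨z, rfl⟩
    refine (le_mul_of_one_le_right (norm_nonneg _) (Real.one_le_exp ?_)).trans (hC z)
    have := sub_nonneg.mpr hle
    positivity
  have hconst (z : ℂ) : θ₁ z = q 0 * θ₂ z := by
    rw [hmul z, hq.apply_eq_apply_of_bounded hb z 0]
  have hone : q 0 = 1 := by
    have h1 := hθ₁.deriv_zero
    rw [show θ₁ = fun z ↦ q 0 * θ₂ z from funext hconst, deriv_const_mul _ (hd₂ 0),
      hθ₂.deriv_zero, mul_one] at h1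
    exact h1
  funext z
  rw [hconst z, hone, one_mul]

theorem IsSpannedBy.eq_normalizedTheta {Γ : Submodule ℤ ℂ} {ω : ℂ} {τ : ℍ}
    (hΓ : IsSpannedBy Γ ω τ) {θ : ℂ → ℂ} (hθ : IsNormalizedTheta Γ θ) :
    θ = normalizedTheta ω τ := by
  obtain ⟨h₁, hh₁⟩ := hθ.isReducedTheta.exists_isQuasiPeriod
  obtain ⟨h₂, hh₂⟩ := hΓ.isNormalizedTheta.isReducedTheta.exists_isQuasiPeriod
  rcases le_total h₁ h₂ with h | h
  · exact hΓ.theta_eq_of_le hθ hΓ.isNormalizedTheta hh₁ hh₂ h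
  · exact (hΓ.theta_eq_of_le hΓ.isNormalizedTheta hθ hh₂ hh₁ h).symm

/-! ### The discriminant as a product -/

lemma latPt_injective (τ : ℍ) : Function.Injective (latPt τ) := by
  intro p p' h
  rw [← sub_eq_zero, ← latPt_eq_zero_iff τ]
  simp only [latPt, Prod.fst_sub, Prod.snd_sub] at h ⊢
  push_cast
  linear_combination h

/-- The coordinates of the points of `ω (ℤτ + ℤ)`. -/
def IsSpannedBy.equiv {Γ : Submodule ℤ ℂ} {ω : ℂ} {τ : ℍ} (hΓ : IsSpannedBy Γ ω τ) : ℤ × ℤ ≃ Γ :=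
  Equiv.ofBijective (fun p ↦ ⟨ω * latPt τ p, (hΓ.mem_iff _).mpr ⟨p, rfl⟩⟩)
    ⟨fun _ _ h ↦ latPt_injective τ (mul_left_cancel₀ hΓ.ne_zero (congrArg Subtype.val h)),
      fun γ ↦ ((hΓ.mem_iff γ).mp γ.2).imp fun _ h ↦ Subtype.ext h.symm⟩

@[simp]
lemma IsSpannedBy.coe_equiv {Γ : Submodule ℤ ℂ} {ω : ℂ} {τ : ℍ} (hΓ : IsSpannedBy Γ ω τ)
    (p : ℤ × ℤ) : (hΓ.equiv p : ℂ) = ω * latPt τ p := rfl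

lemma IsSpannedBy.tsum_inv_pow {Γ : Submodule ℤ ℂ} {ω : ℂ} {τ : ℍ} (hΓ : IsSpannedBy Γ ω τ)
    {k : ℕ} (hk : 3 ≤ k) : ∑' γ : Γ, ((γ : ℂ) ^ k)⁻¹ =
      (ω ^ k)⁻¹ * (riemannZeta k * (2 * ModularForm.E hk τ)) := by
  have h1 : (2 * ModularForm.E hk τ : ℂ) = eisensteinSeries (N := 1) 0 k τ := by
    change 2 * ((1 / 2 : ℂ) * eisensteinSeries (N := 1) 0 k τ) = _
    ring
  rw [h1, ← tsum_eisSummand_eq_riemannZeta_mul_eisensteinSeries hk τ,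
    ← (finTwoArrowEquiv ℤ).symm.tsum_eq, ← hΓ.equiv.tsum_eq, ← tsum_mul_left]
  refine tsum_congr fun p ↦ ?_
  simp [EisensteinSeries.eisSummand, latPt, mul_pow]
  ring

lemma riemannZeta_six : riemannZeta 6 = (π : ℂ) ^ 6 / 945 := by
  have h := riemannZeta_two_mul_nat (k := 3) (by norm_num)
  have hb : bernoulli 6 = 1 / 42 := by
    rw [bernoulli_eq_bernoulli'_of_ne_one (by norm_num)]
    rw [bernoulli'_def]
    norm_num [Finset.sum_range_succ, bernoulli'_eq_zero_of_odd (show Odd 5 by decide) (by norm_num),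
      show Nat.choose 6 2 = 15 by decide, show Nat.choose 6 4 = 15 by decide]
  norm_num [hb, Nat.factorial] at h
  rw [h]
  ring

lemma IsSpannedBy.discr_eq {Γ : Submodule ℤ ℂ} {ω : ℂ} {τ : ℍ} (hΓ : IsSpannedBy Γ ω τ) :
    discr Γ = (2 * π / ω) ^ 12 * ModularForm.discriminant τ := by
  have hω := hΓ.ne_zero
  have h4 := riemannZeta_four
  have h6 := riemannZeta_six
  rw [ModularForm.discriminant_eq_E₄_cube_sub_E₆_sq, discr, g₂, g₃,
    hΓ.tsum_inv_pow (k := 4) (by norm_num), hΓ.tsum_inv_pow (k := 6) (by norm_num)]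
  push_cast
  rw [h4, h6]
  field_simp
  ring

lemma IsSpannedBy.discr_ne_zero {Γ : Submodule ℤ ℂ} {ω : ℂ} {τ : ℍ} (hΓ : IsSpannedBy Γ ω τ) :
    discr Γ ≠ 0 := by
  rw [hΓ.discr_eq]
  have h1 := hΓ.ne_zero
  have h2 := ModularForm.discriminant_ne_zero τ
  have h3 : (π : ℂ) ≠ 0 := by exact_mod_cast Real.pi_ne_zero
  exact mul_ne_zero (pow_ne_zero _ (div_ne_zero (mul_ne_zero two_ne_zero h3) h1)) h2

lemma discriminant_eq_nome_mul_qProd (τ : ℍ) :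
    ModularForm.discriminant τ = nome τ * qProd (nome τ) (nome τ) ^ 24 := by
  have hm : Multipliable fun n : ℕ ↦ 1 - nome τ ^ n * nome τ := by
    simpa [sub_eq_add_neg] using
      multipliable_one_add_of_summable (summable_norm_pow_mul (norm_nome_lt_one τ) (nome τ))
  have hq : Function.Periodic.qParam 1 τ = nome τ := by
    simp [Function.Periodic.qParam, nome]
  rw [ModularForm.discriminant_eq_q_prod, qProd, ← hm.tprod_pow, hq]
  simp_rw [ModularForm.eta_q, hq, pow_succ]

lemma IsSpannedBy.log_norm_discr {Γ : Submodule ℤ ℂ} {ω : ℂ} {τ : ℍ} (hΓ : IsSpannedBy Γ ω τ) :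
    Real.log ‖discr Γ‖ = 12 * (Real.log (2 * π) - Real.log ‖ω‖) - 2 * π * τ.im +
      24 * Real.log ‖qProd (nome τ) (nome τ)‖ := by
  have h1 : ‖ω‖ ≠ 0 := norm_ne_zero_iff.mpr hΓ.ne_zero
  have h2 : ‖qProd (nome τ) (nome τ)‖ ≠ 0 := norm_ne_zero_iff.mpr (qProd_nome_ne_zero τ)
  have h3 : ‖nome τ‖ = Real.exp (-2 * π * τ.im) := norm_exp_two_pi_I_mul τ
  have h4 : ‖(2 * π : ℂ)‖ = 2 * π := by simp [abs_of_pos Real.pi_pos]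
  rw [hΓ.discr_eq, discriminant_eq_nome_mul_qProd, norm_mul, norm_mul, norm_pow, norm_pow, norm_div,
    h3, h4, Real.log_mul (by positivity) (by positivity), Real.log_mul (by positivity)
    (by positivity), Real.log_exp, Real.log_pow, Real.log_pow, Real.log_div (by positivity) h1]
  push_cast
  ring

/-! ### Bases and covolumes of plane lattices -/

lemma isSpannedBy_of_im_pos {Γ : Submodule ℤ ℂ} {u v : ℂ} (him : 0 < (u / v).im)
    (hmem : ∀ z, z ∈ Γ ↔ ∃ m n : ℤ, z = m * u + n * v) : IsSpannedBy Γ v ⟨u / v, him⟩ := by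
  have hv : v ≠ 0 := by
    rintro rfl
    simp at him
  refine ⟨hv, fun z ↦ ?_⟩
  rw [hmem, Prod.exists]
  refine exists_congr fun m ↦ exists_congr fun n ↦ ?_
  rw [latPt, show ((⟨u / v, him⟩ : ℍ) : ℂ) = u / v from rfl]
  field_simp

lemma exists_isSpannedBy (Γ : Submodule ℤ ℂ) [DiscreteTopology Γ] [IsZLattice ℝ Γ] :
    ∃ ω τ, IsSpannedBy Γ ω τ := by
  have := ZLattice.module_free ℝ Γ
  have := ZLattice.module_finite ℝ Γ
  have hr : Module.finrank ℤ Γ = 2 := by rw [ZLattice.rank ℝ Γ, Complex.finrank_real_complex]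
  set b : Module.Basis (Fin 2) ℤ Γ := Module.finBasisOfFinrankEq ℤ Γ hr
  have hli := (b.ofZLatticeBasis ℝ Γ).linearIndependent
  set u : ℂ := ((b 0 : Γ) : ℂ)
  set v : ℂ := ((b 1 : Γ) : ℂ)
  have hmem (z : ℂ) : z ∈ Γ ↔ ∃ m n : ℤ, z = m * u + n * v := by
    constructor
    · intro hz
      refine ⟨b.repr ⟨z, hz⟩ 0, b.repr ⟨z, hz⟩ 1, ?_⟩
      have h := congrArg Subtype.val (b.sum_repr ⟨z, hz⟩)
      rw [Fin.sum_univ_two] at h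
      simpa [u, v] using h.symm
    · rintro ⟨m, n, rfl⟩
      have := Γ.add_mem (Γ.smul_mem m (b 0).2) (Γ.smul_mem n (b 1).2)
      simpa [u, v] using this
  have hlin (s t : ℝ) (h : s * u + t * v = 0) : s = 0 ∧ t = 0 := by
    have h2 := Fintype.linearIndependent_iff.mp hli ![s, t] (by simpa [Fin.sum_univ_two] using h)
    exact ⟨h2 0, h2 1⟩
  have hv : v ≠ 0 := fun h ↦ one_ne_zero (hlin 0 1 (by simp [h])).2
  have hu : u ≠ 0 := fun h ↦ one_ne_zero (hlin 1 0 (by simp [h])).1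
  rcases lt_trichotomy (u / v).im 0 with h | h | h
  · have h' : 0 < (v / u).im := by
      rw [← inv_div u v, inv_im]
      exact div_pos (neg_pos.mpr h) (normSq_pos.mpr (div_ne_zero hu hv))
    exact ⟨_, _, isSpannedBy_of_im_pos h' fun z ↦ (hmem z).trans
      ⟨fun ⟨m, n, e⟩ ↦ ⟨n, m, by rw [e, add_comm]⟩, fun ⟨m, n, e⟩ ↦ ⟨n, m, by rw [e, add_comm]⟩⟩⟩
  · have h1 : u / v = ((u / v).re : ℂ) := Complex.ext (by simp) (by simp [h])
    have h2 := (hlin 1 (-(u / v).re) (by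
      push_cast
      rw [← h1]
      field_simp
      ring)).1
    simp at h2
  · exact ⟨_, _, isSpannedBy_of_im_pos h hmem⟩

/-- The lattice `ω (ℤτ + ℤ)` is also `ωτ (ℤ(-1/τ) + ℤ)`. -/
lemma IsSpannedBy.swap {Γ : Submodule ℤ ℂ} {ω : ℂ} {τ : ℍ} (hΓ : IsSpannedBy Γ ω τ) :
    IsSpannedBy Γ (ω * τ) (ModularGroup.S • τ) := by
  have hτ : (τ : ℂ) ≠ 0 := τ.ne_zero
  refine ⟨mul_ne_zero hΓ.ne_zero hτ, fun z ↦ ?_⟩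
  have key (m n : ℤ) : ω * τ * latPt (ModularGroup.S • τ) (m, n) = ω * latPt τ (n, -m) := by
    rw [latPt, latPt, UpperHalfPlane.modular_S_smul]
    simp
    field_simp
    ring
  rw [hΓ.mem_iff]
  constructor
  · rintro ⟨⟨m, n⟩, rfl⟩
    exact ⟨(-n, m), by rw [key, neg_neg]⟩
  · rintro ⟨⟨m, n⟩, rfl⟩
    exact ⟨_, key m n⟩

/-- The basis `(ωτ, ω)` of `ω (ℤτ + ℤ)`. -/
def IsSpannedBy.basis {Γ : Submodule ℤ ℂ} {ω : ℂ} {τ : ℍ} (hΓ : IsSpannedBy Γ ω τ) :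
    Module.Basis (Fin 2) ℤ Γ :=
  Module.Basis.ofEquivFun <| LinearEquiv.symm
    { (finTwoArrowEquiv ℤ).trans hΓ.equiv with
      map_add' := fun x y ↦ Subtype.ext (by simp [latPt]; ring)
      map_smul' := fun c x ↦ Subtype.ext (by simp [latPt]; ring) }

lemma IsSpannedBy.coe_basis {Γ : Submodule ℤ ℂ} {ω : ℂ} {τ : ℍ} (hΓ : IsSpannedBy Γ ω τ) :
    ((↑) ∘ hΓ.basis : Fin 2 → ℂ) = ![ω * τ, ω] := by
  funext i
  fin_cases i <;> simp [IsSpannedBy.basis, latPt]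

lemma IsSpannedBy.areaDivPi_eq {Γ : Submodule ℤ ℂ} [DiscreteTopology Γ] [IsZLattice ℝ Γ] {ω : ℂ}
    {τ : ℍ} (hΓ : IsSpannedBy Γ ω τ) : areaDivPi Γ = ‖ω‖ ^ 2 * τ.im / π := by
  have h1 := ZLattice.covolume_eq_det_mul_measureReal Γ (μ := volume) hΓ.basis
    Complex.orthonormalBasisOneI.toBasis
  have h2 : (volume : Measure ℂ).real
      (ZSpan.fundamentalDomain Complex.orthonormalBasisOneI.toBasis) = 1 := by
    rw [measureReal_congr (ZSpan.fundamentalDomain_ae_parallelepiped _ volume)]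
    rw [Measure.real, OrthonormalBasis.coe_toBasis, OrthonormalBasis.volume_parallelepiped,
      ENNReal.toReal_one]
  rw [areaDivPi, h1, h2, hΓ.coe_basis, Module.Basis.det_apply, Matrix.det_fin_two]
  simp [Module.Basis.toMatrix_apply]
  have h3 : (ω.re * τ.re - ω.im * τ.im) * ω.im - ω.re * (ω.re * τ.im + ω.im * τ.re) =
      -(‖ω‖ ^ 2 * τ.im) := by
    rw [← normSq_eq_norm_sq, normSq_apply]
    ring
  rw [h3, abs_neg, abs_of_nonneg (by have := τ.im_pos; positivity)]

/-! ### Continuation of the Eisenstein-Kronecker-Lerch series -/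

lemma IsSpannedBy.pairing_eq {Γ : Submodule ℤ ℂ} [DiscreteTopology Γ] [IsZLattice ℝ Γ] {ω : ℂ}
    {τ : ℍ} (hΓ : IsSpannedBy Γ ω τ) (a b : ℝ) (p : ℤ × ℤ) :
    pairing Γ (ω * latPt τ p) (ω * (b * τ + a)) = latChar a b p := by
  have hy : (τ.im : ℂ) ≠ 0 := by exact_mod_cast τ.im_ne_zero
  have hω := hΓ.ne_zero
  have hω' : starRingEnd ℂ ω ≠ 0 := by simpa
  have hn : ((‖ω‖ : ℂ)) ^ 2 = ω * starRingEnd ℂ ω := (mul_conj' ω).symm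
  have hc : starRingEnd ℂ (τ : ℂ) = τ - 2 * I * τ.im := by
    apply Complex.ext <;> simp <;> ring
  rw [pairing, hΓ.areaDivPi_eq, latChar, latPt]
  congr 1
  push_cast
  rw [hn]
  simp only [map_mul, map_add, conj_ofReal, map_intCast, hc]
  field_simp
  ring

lemma IsSpannedBy.hasSum_eklTerm_iff {Γ : Submodule ℤ ℂ} [DiscreteTopology Γ] [IsZLattice ℝ Γ]
    {ω : ℂ} {τ : ℍ} (hΓ : IsSpannedBy Γ ω τ) (a b : ℝ) {s : ℂ} (hs : s ≠ 0) (v : ℂ) :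
    HasSum (fun γ : {γ : Γ // (γ : ℂ) ≠ -0} ↦ eklTerm Γ 0 0 (ω * (b * τ + a)) s ((γ : Γ) : ℂ)) v ↔
      HasSum (fun p ↦ ((‖ω‖ : ℂ) ^ (2 * s))⁻¹ * (latChar a b p / (‖latPt τ p‖ : ℂ) ^ (2 * s))) v := by
  have h0 : 2 * s ≠ 0 := mul_ne_zero two_ne_zero hs
  have h1 := hasSum_subtype_iff_of_support_subset
    (f := fun γ : Γ ↦ eklTerm Γ 0 0 (ω * (b * τ + a)) s (γ : ℂ)) (a := v)
    (s := {γ : Γ | (γ : ℂ) ≠ -0}) (by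
      intro γ hγ h
      apply hγ
      have h' : (γ : ℂ) = 0 := by simpa using h
      simp [eklTerm, h', h0])
  refine h1.trans ?_
  rw [← hΓ.equiv.hasSum_iff]
  suffices h : (fun γ : Γ ↦ eklTerm Γ 0 0 (ω * (b * τ + a)) s (γ : ℂ)) ∘ hΓ.equiv = fun p ↦
      ((‖ω‖ : ℂ) ^ (2 * s))⁻¹ * (latChar a b p / (‖latPt τ p‖ : ℂ) ^ (2 * s)) by rw [h]
  funext p
  rw [Function.comp_apply, hΓ.coe_equiv, eklTerm, hΓ.pairing_eq, zero_add, norm_mul, ofReal_mul,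
    mul_cpow_ofReal_nonneg (norm_nonneg _) (norm_nonneg _)]
  simp only [zpow_zero]
  rw [one_div, mul_inv]
  ring

/-- The factor that relates the Eisenstein-Kronecker-Lerch series to a Mellin transform. -/
def mellinFactor (ω : ℂ) (τ : ℍ) (s : ℂ) : ℂ :=
  (π : ℂ) ^ s / (τ.im : ℂ) ^ s / Gamma s / (‖ω‖ : ℂ) ^ (2 * s)

lemma differentiable_mellinFactor {ω : ℂ} (hω : ω ≠ 0) (τ : ℍ) :
    Differentiable ℂ (mellinFactor ω τ) := by
  have hy : (τ.im : ℂ) ≠ 0 := by exact_mod_cast τ.im_ne_zero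
  have hp : (π : ℂ) ≠ 0 := by exact_mod_cast Real.pi_ne_zero
  have hn : (‖ω‖ : ℂ) ≠ 0 := by exact_mod_cast norm_ne_zero_iff.mpr hω
  have h1 : Differentiable ℂ fun s : ℂ ↦ (π : ℂ) ^ s :=
    fun s ↦ (differentiableAt_id.const_cpow (.inl hp))
  have h2 : Differentiable ℂ fun s : ℂ ↦ (τ.im : ℂ) ^ s :=
    fun s ↦ (differentiableAt_id.const_cpow (.inl hy))
  have h3 : Differentiable ℂ fun s : ℂ ↦ (‖ω‖ : ℂ) ^ (2 * s) :=
    fun s ↦ ((differentiableAt_id.const_mul 2).const_cpow (.inl hn))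
  have h := (((h1.div h2 fun s ↦ by simp [cpow_eq_zero_iff, hy]).mul
    differentiable_one_div_Gamma).div h3 fun s ↦ by simp [cpow_eq_zero_iff, hω])
  exact h

lemma mellinFactor_one (ω : ℂ) (τ : ℍ) : mellinFactor ω τ 1 = π / (‖ω‖ ^ 2 * τ.im) := by
  rw [mellinFactor, mul_one, Complex.Gamma_one, cpow_one, cpow_one, cpow_ofNat]
  ring

/-- The continuation of the Eisenstein-Kronecker-Lerch series, in terms of an entire function `Λ₀`;
it may take junk values at the singularities of its summands. -/
def continuedSeries (ω : ℂ) (τ : ℍ) (Λ₀ : ℂ → ℂ) (d s : ℂ) : ℂ :=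
  mellinFactor ω τ s * (Λ₀ s - 1 / s - d / (1 - s))

lemma meromorphicOn_continuedSeries {ω : ℂ} (hω : ω ≠ 0) (τ : ℍ) {Λ₀ : ℂ → ℂ}
    (hΛ : Differentiable ℂ Λ₀) (d : ℂ) : MeromorphicOn (continuedSeries ω τ Λ₀ d) Set.univ := by
  intro s _
  have h1 := ((differentiable_mellinFactor hω τ).analyticAt s).meromorphicAt
  have h2 := (hΛ.analyticAt s).meromorphicAt
  unfold continuedSeries
  fun_prop

lemma analyticAt_continuedSeries {ω : ℂ} (hω : ω ≠ 0) (τ : ℍ) {Λ₀ : ℂ → ℂ}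
    (hΛ : Differentiable ℂ Λ₀) {d s : ℂ} (hs : s ≠ 0) (hs' : s ≠ 1 ∨ d = 0) :
    AnalyticAt ℂ (continuedSeries ω τ Λ₀ d) s := by
  have h1 := (differentiable_mellinFactor hω τ).analyticAt s
  have h2 := hΛ.analyticAt s
  rcases hs' with h | rfl
  · have h3 : 1 - s ≠ 0 := sub_ne_zero.mpr h.symm
    unfold continuedSeries
    fun_prop (disch := assumption)
  · unfold continuedSeries
    simp only [zero_div, sub_zero]
    fun_prop (disch := assumption)

/-- The series of `ω (ℤτ + ℤ)` has a continuation of the form `continuedSeries`. -/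
lemma IsSpannedBy.exists_continuedSeries {Γ : Submodule ℤ ℂ} [DiscreteTopology Γ] [IsZLattice ℝ Γ]
    {ω : ℂ} {τ : ℍ} (hΓ : IsSpannedBy Γ ω τ) (a b : ℝ) :
    ∃ Λ₀ : ℂ → ℂ, Differentiable ℂ Λ₀ ∧ ∀ s : ℂ, 1 < s.re →
      HasSum (fun γ : {γ : Γ // (γ : ℂ) ≠ -0} ↦ eklTerm Γ 0 0 (ω * (b * τ + a)) s ((γ : Γ) : ℂ))
        (continuedSeries ω τ Λ₀ (dualConst τ a b) s) := by
  obtain ⟨Λ₀, hΛ, h⟩ := exists_entire_hasSum τ a b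
  refine ⟨Λ₀, hΛ, fun s hs ↦ ?_⟩
  have hs0 : s ≠ 0 := by
    rintro rfl
    norm_num at hs
  rw [hΓ.hasSum_eklTerm_iff a b hs0]
  convert! (h s hs).mul_left _ using 1
  rw [continuedSeries, mellinFactor]
  ring

lemma ne_zero_of_one_lt_re {s : ℂ} (hs : 1 < s.re) : s ≠ 0 ∧ s ≠ 1 := by
  constructor <;> rintro rfl <;> norm_num at hs

lemma IsSpannedBy.isEKLContinuation {Γ : Submodule ℤ ℂ} [DiscreteTopology Γ] [IsZLattice ℝ Γ]
    {ω : ℂ} {τ : ℍ} (hΓ : IsSpannedBy Γ ω τ) (w : ℂ) : IsEKLContinuation Γ 0 0 w (ekl Γ 0 0 w) := by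
  suffices h : ∃ F, IsEKLContinuation Γ 0 0 w F by
    rw [ekl, dif_pos h]
    exact h.choose_spec
  obtain ⟨a, b, rfl⟩ := exists_coordinates τ hΓ.ne_zero w
  obtain ⟨Λ₀, hΛ, hsum⟩ := hΓ.exists_continuedSeries a b
  have hm := meromorphicOn_continuedSeries hΓ.ne_zero τ hΛ (dualConst τ a b)
  refine ⟨toMeromorphicNFOn (continuedSeries ω τ Λ₀ (dualConst τ a b)) Set.univ,
    meromorphicNFOn_toMeromorphicNFOn _ _, fun s hs ↦ ?_⟩
  have hs1 : 1 < s.re := by simpa using hs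
  obtain ⟨h0, h1⟩ := ne_zero_of_one_lt_re hs1
  have ha := analyticAt_continuedSeries hΓ.ne_zero τ hΛ (d := dualConst τ a b) h0 (.inl h1)
  rw [toMeromorphicNFOn_eq_toMeromorphicNFAt hm (Set.mem_univ s),
    toMeromorphicNFAt_eq_self.mpr ha.meromorphicNFAt]
  exact hsum s hs1

/-- The identity theorem for meromorphic functions that agree on a half plane. -/
lemma eventuallyEq_of_eq_of_one_lt_re {F G : ℂ → ℂ} (hF : MeromorphicOn F Set.univ)
    (hG : MeromorphicOn G Set.univ) (h : ∀ s : ℂ, 1 < s.re → F s = G s) (s : ℂ) :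
    F =ᶠ[𝓝[≠] s] G := by
  have hm : MeromorphicOn (F - G) Set.univ := hF.sub hG
  have h2 : meromorphicOrderAt (F - G) 2 = ⊤ := by
    rw [meromorphicOrderAt_eq_top_iff]
    have : ∀ᶠ z : ℂ in 𝓝 2, 1 < z.re :=
      (isOpen_lt continuous_const Complex.continuous_re).mem_nhds (by norm_num)
    filter_upwards [this.filter_mono nhdsWithin_le_nhds] with z hz
    simp [h z hz]
  have h3 : meromorphicOrderAt (F - G) s = ⊤ := by
    by_contra hne
    exact hm.meromorphicOrderAt_ne_top_of_isPreconnected isPreconnected_univ (Set.mem_univ s)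
      (Set.mem_univ 2) hne h2
  rw [meromorphicOrderAt_eq_top_iff] at h3
  filter_upwards [h3] with z hz
  exact sub_eq_zero.mp hz

lemma tendsto_ofReal_nhdsGT_one : Tendsto (fun s : ℝ ↦ (s : ℂ)) (𝓝[>] 1) (𝓝[≠] 1) := by
  refine tendsto_nhdsWithin_iff.mpr ⟨?_, ?_⟩
  · have : Tendsto (fun s : ℝ ↦ (s : ℂ)) (𝓝 1) (𝓝 ((1 : ℝ) : ℂ)) :=
      continuous_ofReal.continuousAt
    simpa using this.mono_left nhdsWithin_le_nhds
  · filter_upwards [self_mem_nhdsWithin] with s hs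
    have : (s : ℂ) ≠ 1 := by exact_mod_cast (ne_of_gt hs)
    exact this

lemma IsSpannedBy.ekl_ofReal {Γ : Submodule ℤ ℂ} [DiscreteTopology Γ] [IsZLattice ℝ Γ]
    {ω : ℂ} {τ : ℍ} (hΓ : IsSpannedBy Γ ω τ) (a b : ℝ) {s : ℝ} (hs : 1 < s) :
    ekl Γ 0 0 (ω * (b * τ + a)) s = ((‖ω‖ ^ (-2 * s) : ℝ) : ℂ) * latSum τ a b s := by
  have hs0 : (s : ℂ) ≠ 0 := by exact_mod_cast (by linarith : s ≠ 0)
  have h := (hΓ.isEKLContinuation (ω * (b * τ + a))).hasSum s (by simpa using hs)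
  rw [hΓ.hasSum_eklTerm_iff a b hs0] at h
  have key (x : ℝ) (hx : 0 ≤ x) : ((x : ℂ) ^ (2 * (s : ℂ)))⁻¹ = ((x ^ (-2 * s) : ℝ) : ℂ) := by
    rw [neg_mul, Real.rpow_neg hx, ofReal_inv, ofReal_cpow hx]
    push_cast
    rfl
  rw [← h.tsum_eq, latSum, tsum_mul_left, key _ (norm_nonneg _)]
  congr 1
  refine tsum_congr fun p ↦ ?_
  rw [div_eq_mul_inv, key _ (norm_nonneg _)]

/-! ### The first limit formula -/

lemma tendsto_rpow_two_sub_two_mul_nhdsGT_one (c : ℝ) (hc : 0 < c) :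
    Tendsto (fun s : ℝ ↦ c ^ (2 - 2 * s)) (𝓝[>] 1) (𝓝 1) ∧
      Tendsto (fun s : ℝ ↦ (c ^ (2 - 2 * s) - 1) / (s - 1)) (𝓝[>] 1) (𝓝 (-2 * Real.log c)) := by
  have hd : HasDerivAt (fun s : ℝ ↦ c ^ (2 - 2 * s)) (-2 * Real.log c) 1 := by
    have := (((hasDerivAt_id (1 : ℝ)).const_mul 2).const_sub 2).const_rpow hc
    convert! this using 1
    simp
    ring
  constructor
  · have := hd.continuousAt.tendsto.mono_left (nhdsWithin_le_nhds (s := Set.Ioi 1))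
    simpa using this
  · have := (hasDerivAt_iff_tendsto_slope.mp hd).mono_left
      (nhdsWithin_mono 1 (fun s (hs : 1 < s) ↦ ne_of_gt hs) : 𝓝[>] (1 : ℝ) ≤ 𝓝[≠] 1)
    refine this.congr fun s ↦ ?_
    rw [slope_def_field]
    simp

lemma IsSpannedBy.tendsto_ekl_ofReal {Γ : Submodule ℤ ℂ} [DiscreteTopology Γ] [IsZLattice ℝ Γ]
    {ω : ℂ} {τ : ℍ} (hΓ : IsSpannedBy Γ ω τ) :
    Tendsto (fun s : ℝ ↦ (areaDivPi Γ : ℂ) * ekl Γ 0 0 0 s - 1 / (s - 1)) (𝓝[>] 1)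
      (𝓝 ((-(1 / 12) * Real.log (‖discr Γ‖ ^ 2) - 2 * Real.log (areaDivPi Γ) +
        2 * Real.eulerMascheroniConstant : ℝ) : ℂ)) := by
  have hω : 0 < ‖ω‖ := norm_pos_iff.mpr hΓ.ne_zero
  have hy := τ.im_pos
  obtain ⟨h1, h2⟩ := tendsto_rpow_two_sub_two_mul_nhdsGT_one ‖ω‖ hω
  have h3 := (((continuous_ofReal.tendsto _).comp h1).mul (tendsto_latSum_zero τ)).add
    ((continuous_ofReal.tendsto _).comp h2)
  refine (h3.congr' ?_).trans (le_of_eq ?_)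
  · filter_upwards [self_mem_nhdsWithin] with s hs
    have hs1 : (s : ℂ) - 1 ≠ 0 := sub_ne_zero.mpr (by exact_mod_cast (ne_of_gt hs))
    have h4 := hΓ.ekl_ofReal 0 0 hs
    rw [ofReal_zero, zero_mul, zero_add, mul_zero] at h4
    have h5 : ‖ω‖ ^ (2 - 2 * s) = ‖ω‖ ^ 2 * ‖ω‖ ^ (-2 * s) := by
      rw [show 2 - 2 * s = 2 + -2 * s by ring, Real.rpow_add hω, Real.rpow_two]
    simp only [Function.comp_apply]
    rw [h4, hΓ.areaDivPi_eq, h5]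
    push_cast
    field_simp
    ring
  · congr 1
    rw [Real.log_pow, hΓ.log_norm_discr, hΓ.areaDivPi_eq, Real.log_div (by positivity)
      (by positivity), Real.log_mul (by positivity) hy.ne', Real.log_pow, Real.log_mul two_ne_zero
      Real.pi_ne_zero]
    push_cast
    ring

/-- The pole at `s = 1` is simple and its residue, multiplied by `A(Γ)`, is one, so that the limit
over complex `s` exists and can be computed along real `s > 1`. -/
lemma IsSpannedBy.exists_tendsto_ekl {Γ : Submodule ℤ ℂ} [DiscreteTopology Γ] [IsZLattice ℝ Γ]
    {ω : ℂ} {τ : ℍ} (hΓ : IsSpannedBy Γ ω τ) :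
    ∃ L : ℂ, Tendsto (fun s : ℂ ↦ (areaDivPi Γ : ℂ) * ekl Γ 0 0 0 s - 1 / (s - 1)) (𝓝[≠] 1)
      (𝓝 L) := by
  have hω := hΓ.ne_zero
  obtain ⟨Λ₀, hΛ, hsum⟩ := hΓ.exists_continuedSeries 0 0
  rw [ofReal_zero, zero_mul, zero_add, mul_zero, dualConst_zero] at hsum
  have hE := hΓ.isEKLContinuation 0
  have heq := eventuallyEq_of_eq_of_one_lt_re hE.meromorphic.meromorphicOn
    (meromorphicOn_continuedSeries hω τ hΛ 1)
    (fun s hs ↦ (hE.hasSum s (by simpa using hs)).unique (hsum s hs)) 1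
  set g : ℂ → ℂ := fun s ↦ (areaDivPi Γ : ℂ) * mellinFactor ω τ s with hg
  have hgd : Differentiable ℂ g := (differentiable_mellinFactor hω τ).const_mul _
  have hg1 : g 1 = 1 := by
    have h1 : (‖ω‖ : ℂ) ≠ 0 := by exact_mod_cast norm_ne_zero_iff.mpr hω
    have h2 : (τ.im : ℂ) ≠ 0 := by exact_mod_cast τ.im_ne_zero
    simp only [hg]
    rw [mellinFactor_one, hΓ.areaDivPi_eq]
    push_cast
    have : (π : ℂ) ≠ 0 := by exact_mod_cast Real.pi_ne_zero
    field_simp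
  have hslope := hasDerivAt_iff_tendsto_slope.mp (hgd 1).hasDerivAt
  have hreg : ContinuousAt (fun s ↦ g s * (Λ₀ s - 1 / s)) 1 := by
    have h1 := hgd.continuous.continuousAt (x := 1)
    have h2 := hΛ.continuous.continuousAt (x := 1)
    fun_prop (disch := norm_num)
  refine ⟨_, ((hreg.tendsto.mono_left nhdsWithin_le_nhds).add hslope).congr' ?_⟩
  filter_upwards [heq, self_mem_nhdsWithin] with s hs hs1
  have h3 : s - 1 ≠ 0 := sub_ne_zero.mpr hs1
  have h4 : 1 - s ≠ 0 := sub_ne_zero.mpr (Ne.symm hs1)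
  rw [hs, slope_def_field, hg1, continuedSeries, ← mul_assoc]
  change g s * _ + _ = g s * _ - _
  rw [show 1 / (1 - s) = -(1 / (s - 1)) by rw [← neg_sub s 1, one_div_neg_eq_neg_one_div]]
  ring

theorem IsSpannedBy.tendsto_ekl {Γ : Submodule ℤ ℂ} [DiscreteTopology Γ] [IsZLattice ℝ Γ]
    {ω : ℂ} {τ : ℍ} (hΓ : IsSpannedBy Γ ω τ) :
    Tendsto (fun s : ℂ ↦ (areaDivPi Γ : ℂ) * ekl Γ 0 0 0 s - 1 / (s - 1)) (𝓝[≠] 1)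
      (𝓝 ((-(1 / 12) * Real.log (‖discr Γ‖ ^ 2) - 2 * Real.log (areaDivPi Γ) +
        2 * Real.eulerMascheroniConstant : ℝ) : ℂ)) := by
  obtain ⟨L, hL⟩ := hΓ.exists_tendsto_ekl
  rwa [tendsto_nhds_unique (hL.comp tendsto_ofReal_nhdsGT_one) hΓ.tendsto_ekl_ofReal] at hL

/-! ### The second limit formula -/

lemma log_norm_productTheta {τ : ℍ} {z : ℂ} (hz : productTheta τ z ≠ 0) :
    Real.log ‖productTheta τ z‖ = π / (2 * τ.im) * (z.re ^ 2 - z.im ^ 2) + π * z.im +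
      (Real.log ‖qProd (nome τ) (cexp (2 * π * I * z))‖ +
        Real.log ‖qProd (nome τ) (cexp (2 * π * I * (τ - z)))‖) := by
  have h1 : ((π / (2 * τ.im) * z ^ 2 - π * I * z : ℂ)).re =
      π / (2 * τ.im) * (z.re ^ 2 - z.im ^ 2) + π * z.im := by
    rw [show (π / (2 * τ.im) : ℂ) = ((π / (2 * τ.im) : ℝ) : ℂ) by push_cast; rfl,
      sub_re, re_ofReal_mul]
    simp [pow_two]
  rw [productTheta] at hz ⊢
  obtain ⟨h2, h3⟩ := mul_ne_zero_iff.mp (right_ne_zero_of_mul hz)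
  rw [norm_mul, norm_mul, norm_exp, Real.log_mul (Real.exp_pos _).ne'
    (mul_ne_zero (norm_ne_zero_iff.mpr h2) (norm_ne_zero_iff.mpr h3)), Real.log_exp,
    Real.log_mul (norm_ne_zero_iff.mpr h2) (norm_ne_zero_iff.mpr h3), h1]

lemma latChar_fract (a b : ℝ) (p : ℤ × ℤ) : latChar a (Int.fract b) p = latChar a b p := by
  have h : (2 * π * I * (p.1 * a - p.2 * (Int.fract b : ℝ)) : ℂ) =
      2 * π * I * (p.1 * a - p.2 * b) + ((p.2 * ⌊b⌋ : ℤ) : ℂ) * (2 * π * I) := by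
    rw [Int.fract]
    push_cast
    ring
  rw [latChar, h, Complex.exp_add, Complex.exp_int_mul_two_pi_mul_I, mul_one, latChar]

/-- The right hand side of the second limit formula, up to an additive constant, is periodic. -/
lemma IsSpannedBy.theta_add {Γ : Submodule ℤ ℂ} [DiscreteTopology Γ] [IsZLattice ℝ Γ]
    {ω : ℂ} {τ : ℍ} (hΓ : IsSpannedBy Γ ω τ) {z γ : ℂ} (hz : z ∉ Γ) (hγ : γ ∈ Γ) :
    -Real.log (‖normalizedTheta ω τ (z + γ)‖ ^ 2) + ‖z + γ‖ ^ 2 / areaDivPi Γ =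
      -Real.log (‖normalizedTheta ω τ z‖ ^ 2) + ‖z‖ ^ 2 / areaDivPi Γ := by
  have hω : ‖ω‖ ≠ 0 := norm_ne_zero_iff.mpr hΓ.ne_zero
  have hy := τ.im_ne_zero
  have hz' : z + γ ∉ Γ := fun h ↦ hz (by simpa using Γ.sub_mem h hγ)
  have h1 : ‖normalizedTheta ω τ z‖ ≠ 0 :=
    norm_ne_zero_iff.mpr fun h ↦ hz ((hΓ.normalizedTheta_eq_zero_iff z).mp h)
  have h2 : ‖normalizedTheta ω τ (z + γ)‖ ≠ 0 :=
    norm_ne_zero_iff.mpr fun h ↦ hz' ((hΓ.normalizedTheta_eq_zero_iff _).mp h)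
  have h3 := congrArg Real.log
    ((hΓ.isQuasiPeriod (ω / deriv (productTheta τ) 0) hγ).norm_mul_exp z)
  change Real.log (‖normalizedTheta ω τ (z + γ)‖ * _) =
    Real.log (‖normalizedTheta ω τ z‖ * _) at h3
  rw [Real.log_mul h2 (Real.exp_pos _).ne', Real.log_mul h1 (Real.exp_pos _).ne', Real.log_exp,
    Real.log_exp] at h3
  rw [hΓ.areaDivPi_eq, Real.log_pow, Real.log_pow]
  have h4 (x : ℝ) : x ^ 2 / (‖ω‖ ^ 2 * τ.im / π) = 2 * (π / 2 * (1 / τ.im / ‖ω‖ ^ 2) * x ^ 2) := by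
    field_simp
  rw [h4, h4]
  push_cast
  linear_combination -2 * h3

/-- The second limit formula at a point that is not on a line through a point of `Γ` with direction
`ω`. Replacing `b` by its fractional part changes neither the character nor, by
`IsSpannedBy.theta_add`, the right hand side. -/
lemma IsSpannedBy.ekl_one_of_fract_ne_zero {Γ : Submodule ℤ ℂ} [DiscreteTopology Γ]
    [IsZLattice ℝ Γ] {ω : ℂ} {τ : ℍ} (hΓ : IsSpannedBy Γ ω τ) (a : ℝ) {b : ℝ}
    (hb : Int.fract b ≠ 0) :
    AnalyticAt ℂ (ekl Γ 0 0 (ω * (b * τ + a))) 1 ∧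
      (areaDivPi Γ : ℂ) * ekl Γ 0 0 (ω * (b * τ + a)) 1 =
        ((-Real.log (‖normalizedTheta ω τ (ω * (b * τ + a))‖ ^ 2) +
          ‖ω * (b * τ + a)‖ ^ 2 / areaDivPi Γ - 1 / 12 * Real.log (‖discr Γ‖ ^ 2) : ℝ) : ℂ) := by
  have hω := hΓ.ne_zero
  have hω' : 0 < ‖ω‖ := norm_pos_iff.mpr hω
  have hy := τ.im_pos
  set β := Int.fract b with hβ
  have hβ' : β ∈ Set.Ioo 0 1 := ⟨(Int.fract_nonneg b).lt_of_ne' hb, Int.fract_lt_one b⟩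
  have hmem {c : ℝ} (hc : Int.fract c ≠ 0) (p : ℤ × ℤ) : (c * τ + a : ℂ) ≠ latPt τ p := fun h ↦ by
    have h1 := congrArg Complex.im h
    simp only [latPt, add_im, im_ofReal_mul, ofReal_im, add_zero, intCast_im,
      ← ofReal_intCast p.1] at h1
    have h2 : c = p.1 := mul_right_cancel₀ τ.im_ne_zero h1
    exact hc (by rw [h2, Int.fract_intCast])
  have hz : (ω * (β * τ + a) : ℂ) ∉ Γ := fun h ↦ by
    obtain ⟨p, hp⟩ := (hΓ.mem_iff _).mp h
    exact hmem (by rwa [hβ, Int.fract_fract]) p (mul_left_cancel₀ hω hp)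
  have hγ : ω * (⌊b⌋ * τ) ∈ Γ := (hΓ.mem_iff _).mpr ⟨(⌊b⌋, 0), by simp [latPt]⟩
  have hadd : ω * (b * (τ : ℂ) + a) = ω * (β * τ + a) + ω * (⌊b⌋ * τ) := by
    rw [hβ, Int.fract]
    push_cast
    ring
  have hE := hΓ.isEKLContinuation (ω * (b * τ + a))
  obtain ⟨Λ₀, hΛ, hsum⟩ := hΓ.exists_continuedSeries a b
  rw [dualConst_eq_zero τ (hmem hb)] at hsum
  have heq := eventuallyEq_of_eq_of_one_lt_re hE.meromorphic.meromorphicOn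
    (meromorphicOn_continuedSeries hω τ hΛ 0)
    (fun s hs ↦ (hE.hasSum s (by simpa using hs)).unique (hsum s hs)) 1
  have han : AnalyticAt ℂ (ekl Γ 0 0 (ω * (b * τ + a))) 1 := by
    rw [← (hE.meromorphic (Set.mem_univ 1)).meromorphicOrderAt_nonneg_iff_analyticAt,
      meromorphicOrderAt_congr heq]
    exact (analyticAt_continuedSeries hω τ hΛ one_ne_zero (.inr rfl)).meromorphicOrderAt_nonneg
  refine ⟨han, ?_⟩
  have hlim1 := ((han.continuousAt.tendsto.mono_left nhdsWithin_le_nhds).comp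
    tendsto_ofReal_nhdsGT_one).const_mul (areaDivPi Γ : ℂ)
  obtain ⟨h1, -⟩ := tendsto_rpow_two_sub_two_mul_nhdsGT_one ‖ω‖ hω'
  have hlim2 := ((((continuous_ofReal.tendsto _).comp h1).mul
    (tendsto_latSum τ a hβ')).const_mul (τ.im / π : ℂ))
  have hlim3 := hlim2.congr' (f₂ := fun s : ℝ ↦
      (areaDivPi Γ : ℂ) * ekl Γ 0 0 (ω * (b * τ + a)) s) (by
    filter_upwards [self_mem_nhdsWithin] with s hs
    have h5 : ‖ω‖ ^ (2 - 2 * s) = ‖ω‖ ^ 2 * ‖ω‖ ^ (-2 * s) := by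
      rw [show 2 - 2 * s = 2 + -2 * s by ring, Real.rpow_add hω', Real.rpow_two]
    simp only [Function.comp_apply]
    rw [hΓ.ekl_ofReal a b hs, hΓ.areaDivPi_eq, h5, latSum, latSum]
    simp_rw [hβ, latChar_fract]
    push_cast
    ring)
  rw [tendsto_nhds_unique hlim1 hlim3, hadd, hΓ.theta_add hz hγ]
  have hne : productTheta τ (β * τ + a) ≠ 0 := by
    rw [Ne, productTheta_eq_zero_iff]
    rintro ⟨p, hp⟩
    exact hz ((hΓ.mem_iff _).mpr ⟨p, by rw [hp]⟩)
  have hq : ‖qProd (nome τ) (nome τ)‖ ≠ 0 := norm_ne_zero_iff.mpr (qProd_nome_ne_zero τ)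
  have hlog : Real.log ‖normalizedTheta ω τ (ω * (β * τ + a))‖ =
      Real.log ‖ω‖ - (Real.log (2 * π) + 2 * Real.log ‖qProd (nome τ) (nome τ)‖) +
        Real.log ‖productTheta τ (β * τ + a)‖ := by
    rw [normalizedTheta, mul_div_cancel_left₀ _ hω, norm_mul, norm_div, deriv_productTheta_zero,
      norm_mul, norm_neg, norm_pow,
      show ‖(2 * π * I : ℂ)‖ = 2 * π by simp [abs_of_pos Real.pi_pos],
      Real.log_mul (by positivity) (norm_ne_zero_iff.mpr hne), Real.log_div hω'.ne'
      (by positivity), Real.log_mul (by positivity) (by positivity), Real.log_pow]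
    norm_num
  have harg : (τ : ℂ) - (β * τ + a) = (1 - β) * τ - a := by ring
  have hnorm : ‖(ω * (β * τ + a) : ℂ)‖ ^ 2 =
      ‖ω‖ ^ 2 * ((β * τ.re + a) ^ 2 + (β * τ.im) ^ 2) := by
    rw [norm_mul, mul_pow, ← normSq_eq_norm_sq (_ + _), normSq_apply]
    congr 1
    simp
    ring
  rw [Real.log_pow, Real.log_pow, hlog, log_norm_productTheta hne, hΓ.log_norm_discr, harg, hnorm,
    hΓ.areaDivPi_eq]
  rw [ofReal_one, one_mul, ← ofReal_div, ← ofReal_mul]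
  congr 1
  simp only [add_re, add_im, re_ofReal_mul, im_ofReal_mul, ofReal_re, ofReal_im, coe_re, coe_im,
    add_zero]
  push_cast
  field_simp
  ring

theorem IsSpannedBy.ekl_one {Γ : Submodule ℤ ℂ} [DiscreteTopology Γ] [IsZLattice ℝ Γ]
    {ω : ℂ} {τ : ℍ} (hΓ : IsSpannedBy Γ ω τ) {θ : ℂ → ℂ} (hθ : IsNormalizedTheta Γ θ) {z : ℂ}
    (hz : z ∉ Γ) :
    AnalyticAt ℂ (ekl Γ 0 0 z) 1 ∧ (areaDivPi Γ : ℂ) * ekl Γ 0 0 z 1 =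
      ((-Real.log (‖θ z‖ ^ 2) + ‖z‖ ^ 2 / areaDivPi Γ -
        1 / 12 * Real.log (‖discr Γ‖ ^ 2) : ℝ) : ℂ) := by
  obtain ⟨a, b, rfl⟩ := exists_coordinates τ hΓ.ne_zero z
  by_cases hb : Int.fract b = 0
  · -- On the line through `0` and `ω` the roles of the two basis vectors are exchanged.
    have ha : Int.fract (-a) ≠ 0 := fun h ↦ by
      obtain ⟨m, hm⟩ := Int.fract_eq_zero_iff.mp hb
      obtain ⟨n, hn⟩ := Int.fract_eq_zero_iff.mp h
      refine hz ((hΓ.mem_iff _).mpr ⟨(m, -n), ?_⟩)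
      have ha : a = -n := by rw [hn, neg_neg]
      rw [← hm, ha]
      simp [latPt]
    have hτ : (τ : ℂ) ≠ 0 := τ.ne_zero
    have hco : ω * (b * (τ : ℂ) + a) =
        ω * τ * ((-a : ℝ) * ((ModularGroup.S • τ : ℍ) : ℂ) + b) := by
      rw [UpperHalfPlane.modular_S_smul]
      simp
      field_simp
      ring
    rw [hΓ.swap.eq_normalizedTheta hθ, hco]
    exact hΓ.swap.ekl_one_of_fract_ne_zero b ha
  · rw [hΓ.eq_normalizedTheta hθ]
    exact hΓ.ekl_one_of_fract_ne_zero a hb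

end

end KroneckerLimit

theorem theorem1p1 (Γ : Submodule ℤ ℂ) [DiscreteTopology Γ] [IsZLattice ℝ Γ] :
    -- the functions in the two formulas are well defined, and the discriminant does not vanish
    (∀ w : ℂ, KroneckerLimit.IsEKLContinuation Γ 0 0 w (KroneckerLimit.ekl Γ 0 0 w)) ∧
    (∃! θ : ℂ → ℂ, KroneckerLimit.IsNormalizedTheta Γ θ) ∧
    KroneckerLimit.discr Γ ≠ 0 ∧
    -- the first limit formula
    Tendsto
      (fun s : ℂ => (KroneckerLimit.areaDivPi Γ : ℂ) * KroneckerLimit.ekl Γ 0 0 0 s - 1 / (s - 1))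
      (𝓝[≠] 1)
      (𝓝 ((-(1 / 12) * Real.log (‖KroneckerLimit.discr Γ‖ ^ 2)
        - 2 * Real.log (KroneckerLimit.areaDivPi Γ) + 2 * Real.eulerMascheroniConstant : ℝ) : ℂ)) ∧
    -- the second limit formula
    (∀ θ : ℂ → ℂ, KroneckerLimit.IsNormalizedTheta Γ θ → ∀ z : ℂ, z ∉ Γ →
      AnalyticAt ℂ (KroneckerLimit.ekl Γ 0 0 z) 1 ∧
      (KroneckerLimit.areaDivPi Γ : ℂ) * KroneckerLimit.ekl Γ 0 0 z 1 =
        ((-Real.log (‖θ z‖ ^ 2) + ‖z‖ ^ 2 / KroneckerLimit.areaDivPi Γ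
          - 1 / 12 * Real.log (‖KroneckerLimit.discr Γ‖ ^ 2) : ℝ) : ℂ)) := by
  obtain ⟨ω, τ, hΓ⟩ := KroneckerLimit.exists_isSpannedBy Γ
  exact ⟨hΓ.isEKLContinuation, ⟨_, hΓ.isNormalizedTheta, fun θ hθ ↦ hΓ.eq_normalizedTheta hθ⟩,
    hΓ.discr_ne_zero, hΓ.tendsto_ekl, fun θ hθ z hz ↦ hΓ.ekl_one hθ hz⟩
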